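/- Let $Y$ be a real or complex Banach space with dual $Y^*$, let $S$ be a $C_0$-semigroup of bounded linear operators on $Y$, let $0<h<\infty$, and let $X=C([-h,0];Y)$ with the supremum norm. The shift semigroup $T_0$ on $X$ is the $C_0$-semigroup $$(T_0(t)\phi)(\theta)=\begin{cases}\phi(t+\theta), & -h\le t+\theta\le 0,\\ S(t+\theta)\phi(0), & t+\theta\ge 0,\end{cases}\qquad t\ge 0,\ \theta\in[-h,0].$$ For a $C_0$-semigroup $T$ on a Banach space $E$ let $T^*$ be the adjoint semigroup on $E^*$, let $E^\odot=\{x^*\in E^*: \|T^*(t)x^*-x^*\|\to 0 \text{ as } t\downarrow 0\}$ be the sun dual (the maximal subspace of strong continuity of $T^*$), with the norm of $E^*$, and let $T^\odot(t)$ be the restriction of $T^*(t)$ to $E^\odot$. Let $Y^\odot$ be the sun dual with respect to $S$ and $X^\odot$ the sun dual with respect to $T_0$. Let $\mathrm{NBV}([0,h],Y^*)$ be the space of functions $f:[0,h]\to Y^*$ of bounded variation with $f(0)=0$ that are right-continuous on $(0,h)$, with the total variation norm. An element $x^*\in X^*$ is identified with the function $f\in\mathrm{NBV}([0,h],Y^*)$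 that represents it, i.e. $\langle\phi,x^*\rangle=\int_0^h\phi(-\theta)\,df(\theta)$ (Riemann–Stieltjes integral) for all $\phi\in X$. Let $\chi_0$ be the characteristic function of $(0,h]$, let $L^1([0,h],Y^*)$ be the space of Bochner integrable functions, and for $t \ge 0$ and $g\in L^1([0,h],Y^*)$ let $(T_1(t)g)(\theta)=g(t+\theta)$ if $t+\theta\le h$ and $(T_1(t)g)(\theta)=0$ if $t+\theta>h$. Then, with this identification, $$X^\odot=\Bigl\{f:[0,h]\to Y^* : \exists\, y^\odot\in Y^\odot,\ g\in L^1([0,h],Y^*) \text{ with } f(t)=\chi_0(t)y^\odot+\int_0^t g(s)\,ds\ \ \forall t\in[0,h]\Bigr\},$$ and the map $\iota:Y^\odot\times L^1([0,h],Y^*)\to X^\odot$, $\iota(y^\odot,g)(t)=\chi_0(t)y^\odot+\int_0^t g(s)\,ds$, is an isometric linear isomorphism onto $X^\odot$, where the product carries the norm $\|y^\odot\|+\|g\|_{L^1}$; this norm equals both the norm of $\iota(y^\odot,g)$ as a functional on $X$ and the total variation of $\iota(y^\odot,g)$ as a function on $[0,h]$. For $\phi\in X$ and $\phi^\odot=\iota(y^\odot,g)$,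 $$\langle\phi,\phi^\odot\rangle=\langle\phi(0),y^\odot\rangle+\int_0^h\langle\phi(-\theta),g(\theta)\rangle\,d\theta .$$ Moreover, for all $t\ge 0$, $$T_0^\odot(t)\phi^\odot=\iota\Bigl(S^\odot(t)y^\odot+\int_0^{\min(t,h)}S^*(t-\theta)g(\theta)\,d\theta,\ T_1(t)g\Bigr),$$ where the integral on the right is a weak$^*$ Lebesgue integral whose value lies in $Y^\odot$. -/

import Mathlib

open Set Filter Topology MeasureTheory
open scoped NNReal ENNReal

noncomputable section

/-- A strongly continuous one-parameter semigroup of bounded linear operators on `E`. -/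
structure C0Semigroup (𝕜 E : Type*) [RCLike 𝕜] [NormedAddCommGroup E] [NormedSpace 𝕜 E] where
  /-- the operator at time `t` -/
  op : ℝ≥0 → E →L[𝕜] E
  op_zero : op 0 = ContinuousLinearMap.id 𝕜 E
  op_add : ∀ s t : ℝ≥0, op (s + t) = (op s).comp (op t)
  continuous_orbit : ∀ x : E, Continuous fun t : ℝ≥0 => op t x

namespace C0Semigroup

section SunDual

variable {𝕜 E : Type*} [RCLike 𝕜] [NormedAddCommGroup E] [NormedSpace 𝕜 E]

/-- The adjoint semigroup on the dual space: `⟨x, T*(t) x*⟩ = ⟨T(t) x, x*⟩`. -/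
def adj (T : C0Semigroup 𝕜 E) (t : ℝ≥0) : StrongDual 𝕜 E →L[𝕜] StrongDual 𝕜 E :=
  ContinuousLinearMap.precomp 𝕜 (T.op t)

theorem adj_apply (T : C0Semigroup 𝕜 E) (t : ℝ≥0) (f : StrongDual 𝕜 E) (x : E) :
    T.adj t f x = f (T.op t x) := rfl

theorem adj_comm (T : C0Semigroup 𝕜 E) (s t : ℝ≥0) (f : StrongDual 𝕜 E) :
    T.adj s (T.adj t f) = T.adj t (T.adj s f) := by
  ext x
  simp only [adj_apply]
  have h1 := congrArg (fun L => f (L x)) (T.op_add t s)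
  have h2 := congrArg (fun L => f (L x)) (T.op_add s t)
  simp only [ContinuousLinearMap.comp_apply] at h1 h2
  rw [← h1, ← h2, add_comm]

/-- The sun dual: the maximal subspace of strong continuity of the adjoint semigroup, i.e. the
functionals `x*` with `‖T*(t) x* - x*‖ → 0` as `t ↓ 0`. -/
def sunDual (T : C0Semigroup 𝕜 E) : Submodule 𝕜 (StrongDual 𝕜 E) where
  carrier := {f | Tendsto (fun t : ℝ≥0 => T.adj t f) (𝓝 0) (𝓝 f)}
  add_mem' := by
    intro f g hf hg
    simp only [mem_ofPred_eq, map_add] at *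
    exact hf.add hg
  zero_mem' := by simp
  smul_mem' := by
    intro c f hf
    simp only [mem_ofPred_eq, map_smul] at *
    exact hf.const_smul c

theorem adj_mem_sunDual (T : C0Semigroup 𝕜 E) (t : ℝ≥0) (f : T.sunDual) :
    T.adj t (f : StrongDual 𝕜 E) ∈ T.sunDual := by
  have hf : Tendsto (fun s : ℝ≥0 => T.adj s (f : StrongDual 𝕜 E)) (𝓝 0) (𝓝 f) := f.2
  change Tendsto (fun s : ℝ≥0 => T.adj s (T.adj t (f : StrongDual 𝕜 E))) (𝓝 0) (𝓝 _)
  simp only [T.adj_comm _ t]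
  exact ((T.adj t).continuous.tendsto _).comp hf

/-- The sun semigroup: the restriction of the adjoint semigroup to the sun dual. -/
def sunOp (T : C0Semigroup 𝕜 E) (t : ℝ≥0) : T.sunDual →L[𝕜] T.sunDual :=
  ((T.adj t).comp T.sunDual.subtypeL).codRestrict T.sunDual (T.adj_mem_sunDual t)

end SunDual

section Shift

variable {𝕜 Y : Type*} [RCLike 𝕜] [NormedAddCommGroup Y] [NormedSpace 𝕜 Y]
  (S : C0Semigroup 𝕜 Y) {h : ℝ} (hh : 0 < h)

/-- The solution `x : [-h, ∞) → Y` of `x' = B x` on `[0, ∞)` with history `φ` on `[-h, 0]`, where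
`B` is the generator of `S`. (Values at arguments below `-h` are irrelevant.) -/
def solution (φ : C(Icc (-h) 0, Y)) (s : ℝ) : Y :=
  if s ≤ 0 then IccExtend (neg_nonpos.2 hh.le) φ s else S.op s.toNNReal (φ ⟨0, by simp [hh.le]⟩)

theorem solution_of_nonneg (φ : C(Icc (-h) 0, Y)) {s : ℝ} (hs : 0 ≤ s) :
    S.solution hh φ s = S.op s.toNNReal (φ ⟨0, by simp [hh.le]⟩) := by
  unfold solution
  split_ifs with h0
  · have : s = 0 := le_antisymm h0 hs
    subst this
    rw [IccExtend_of_mem _ _ ⟨neg_nonpos.2 hh.le, le_rfl⟩]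
    simp [S.op_zero]
  · rfl

theorem solution_of_mem (φ : C(Icc (-h) 0, Y)) {s : ℝ} (hs : s ∈ Icc (-h) 0) :
    S.solution hh φ s = φ ⟨s, hs⟩ := by
  unfold solution
  rw [if_pos hs.2, IccExtend_of_mem _ _ hs]

theorem continuous_solution (φ : C(Icc (-h) 0, Y)) : Continuous (S.solution hh φ) := by
  unfold solution
  refine Continuous.if_le ?_ ?_ continuous_id continuous_const ?_
  · exact φ.continuous.Icc_extend'
  · exact (S.continuous_orbit _).comp continuous_real_toNNReal
  · intro s hs
    subst hs
    rw [IccExtend_of_mem _ _ ⟨neg_nonpos.2 hh.le, le_rfl⟩]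
    simp [S.op_zero]

/-- The history at time `t` of the solution: `(T₀(t) φ)(θ) = x(t + θ)`. -/
def shiftFun (t : ℝ≥0) (φ : C(Icc (-h) 0, Y)) : C(Icc (-h) 0, Y) where
  toFun θ := S.solution hh φ (t + θ)
  continuous_toFun := (S.continuous_solution hh φ).comp (by fun_prop)

theorem exists_bound [CompleteSpace Y] (t : ℝ≥0) : ∃ M : ℝ, ∀ s ≤ t, ‖S.op s‖ ≤ M := by
  obtain ⟨M, hM⟩ := banach_steinhaus (g := fun s : Iic t => S.op s) (by
    intro x
    have hc : IsCompact ((fun s : ℝ≥0 => S.op s x) '' Icc 0 t) :=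
      isCompact_Icc.image (S.continuous_orbit x)
    obtain ⟨C, hC⟩ := hc.isBounded.exists_norm_le
    exact ⟨C, fun s => hC _ ⟨s, ⟨zero_le, s.2⟩, rfl⟩⟩)
  exact ⟨M, fun s hs => hM ⟨s, hs⟩⟩

theorem shiftFun_add_vec (t : ℝ≥0) (φ ψ : C(Icc (-h) 0, Y)) :
    S.shiftFun hh t (φ + ψ) = S.shiftFun hh t φ + S.shiftFun hh t ψ := by
  ext θ
  simp only [shiftFun, solution, ContinuousMap.coe_mk, ContinuousMap.add_apply]
  split_ifs <;> simp [IccExtend]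

theorem shiftFun_smul_vec (t : ℝ≥0) (c : 𝕜) (φ : C(Icc (-h) 0, Y)) :
    S.shiftFun hh t (c • φ) = c • S.shiftFun hh t φ := by
  ext θ
  simp only [shiftFun, solution, ContinuousMap.coe_mk, ContinuousMap.smul_apply]
  split_ifs <;> simp [IccExtend]

theorem exists_shiftFun_bound [CompleteSpace Y] (t : ℝ≥0) :
    ∃ C : ℝ, ∀ φ : C(Icc (-h) 0, Y), ‖S.shiftFun hh t φ‖ ≤ C * ‖φ‖ := by
  obtain ⟨M, hM⟩ := S.exists_bound t
  refine ⟨max M 1, fun φ => ?_⟩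
  have h1 : (0 : ℝ) ≤ max M 1 := le_trans zero_le_one (le_max_right _ _)
  rw [ContinuousMap.norm_le _ (by positivity)]
  intro θ
  simp only [shiftFun, solution, ContinuousMap.coe_mk]
  split_ifs with h0
  · calc ‖IccExtend _ φ _‖ ≤ ‖φ‖ := φ.norm_coe_le_norm _
      _ ≤ max M 1 * ‖φ‖ := le_mul_of_one_le_left (norm_nonneg _) (le_max_right _ _)
  · refine ((S.op _).le_opNorm _).trans ?_
    have hs : ((t : ℝ) + θ).toNNReal ≤ t := by
      rw [Real.toNNReal_le_iff_le_coe]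
      linarith [θ.2.2]
    gcongr
    · exact (hM _ hs).trans (le_max_left _ _)
    · exact φ.norm_coe_le_norm _

/-- The shift semigroup `T₀` on `C([-h, 0]; Y)`, built from the semigroup `S` on `Y`:
`(T₀(t) φ)(θ) = φ(t + θ)` if `t + θ ≤ 0` and `(T₀(t) φ)(θ) = S(t + θ) φ(0)` if `t + θ ≥ 0`. -/
def shiftSemigroup [CompleteSpace Y] : C0Semigroup 𝕜 C(Icc (-h) 0, Y) where
  op t := LinearMap.mkContinuousOfExistsBound
    { toFun := S.shiftFun hh t
      map_add' := S.shiftFun_add_vec hh t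
      map_smul' := S.shiftFun_smul_vec hh t } (S.exists_shiftFun_bound hh t)
  op_zero := by
    ext φ θ
    change S.solution hh φ ((0 : ℝ≥0) + θ) = φ θ
    rw [NNReal.coe_zero, zero_add, S.solution_of_mem hh φ θ.2]
  op_add s t := by
    ext φ θ
    change S.solution hh φ ((s + t : ℝ≥0) + θ) =
      S.solution hh (S.shiftFun hh t φ) (s + θ)
    have hθ := θ.2
    rcases le_total ((s : ℝ) + θ) 0 with h0 | h0
    · rw [S.solution_of_mem hh _ ⟨by linarith [hθ.1, s.2], h0⟩]
      simp only [shiftFun, ContinuousMap.coe_mk]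
      congr 1
      push_cast
      ring
    · rw [S.solution_of_nonneg hh _ h0]
      have h1 : 0 ≤ (s + t : ℝ≥0) + (θ : ℝ) := by
        push_cast
        linarith [t.2]
      simp only [shiftFun, ContinuousMap.coe_mk, add_zero]
      rw [S.solution_of_nonneg hh _ h1, S.solution_of_nonneg hh φ t.coe_nonneg,
        ← ContinuousLinearMap.comp_apply, ← S.op_add]
      congr 2
      ext
      simp only [NNReal.coe_add, Real.coe_toNNReal _ h0, Real.toNNReal_coe,
        Real.coe_toNNReal ((s : ℝ) + t + θ) (by simpa using h1)]
      ring
  continuous_orbit φ := by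
    let F : C(ℝ≥0 × Icc (-h) 0, Y) :=
      ⟨fun p => S.solution hh φ (p.1 + p.2), (S.continuous_solution hh φ).comp (by fun_prop)⟩
    exact F.curry.continuous

theorem shiftSemigroup_apply [CompleteSpace Y] (t : ℝ≥0) (φ : C(Icc (-h) 0, Y))
    (θ : Icc (-h) 0) : (S.shiftSemigroup hh).op t φ θ = S.solution hh φ (t + θ) := rfl

end Shift

end C0Semigroup

/-- A tagged partition `a = σ₀ < σ₁ < ⋯ < σ_N = b` of `[a, b]` with sample points
`τ_j ∈ [σ_j, σ_{j+1}]`. -/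
structure TaggedPartition (a b : ℝ) where
  N : ℕ
  pt : Fin (N + 1) → Icc a b
  strictMono_pt : StrictMono pt
  pt_zero : (pt 0 : ℝ) = a
  pt_last : (pt (Fin.last N) : ℝ) = b
  tag : Fin N → Icc a b
  le_tag : ∀ j, pt j.castSucc ≤ tag j
  tag_le : ∀ j, tag j ≤ pt j.succ

/-- The mesh width of the partition is at most `δ`. -/
def TaggedPartition.MeshLE {a b : ℝ} (P : TaggedPartition a b) (δ : ℝ) : Prop :=
  ∀ j : Fin P.N, (P.pt j.succ : ℝ) - P.pt j.castSucc ≤ δ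

section RiemannStieltjes

variable {𝕜 V : Type*} [RCLike 𝕜] [NormedAddCommGroup V] [NormedSpace 𝕜 V]

/-- The Riemann-Stieltjes sum `∑ ⟨f(τ_j), η(σ_{j+1}) - η(σ_j)⟩`. -/
def rsSum {a b : ℝ} (f : Icc a b → V) (η : Icc a b → StrongDual 𝕜 V)
    (P : TaggedPartition a b) : 𝕜 :=
  ∑ j : Fin P.N, (η (P.pt j.succ) - η (P.pt j.castSucc)) (f (P.tag j))

/-- `f` is Riemann-Stieltjes integrable with respect to `η` over `[a, b]`, and `∫_a^b f dη = z`. -/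
def HasRSIntegral {a b : ℝ} (f : Icc a b → V) (η : Icc a b → StrongDual 𝕜 V) (z : 𝕜) : Prop :=
  ∀ ε > 0, ∃ δ > 0, ∀ P : TaggedPartition a b, P.MeshLE δ → ‖rsSum f η P - z‖ ≤ ε

/-- Functions of normalized bounded variation on `[0, h]`: bounded variation, zero at `0` and
right-continuous on the open interval `(0, h)`. -/
structure IsNBV {W : Type*} [NormedAddCommGroup W] {h : ℝ} (f : Icc 0 h → W) : Prop where
  boundedVariation : BoundedVariationOn f univ
  map_zero : ∀ t : Icc 0 h, (t : ℝ) = 0 → f t = 0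
  right_continuous : ∀ t : Icc 0 h, 0 < (t : ℝ) → (t : ℝ) < h → ContinuousWithinAt f (Ici t) t

/-- The function `f : [0, h] → V*` represents the functional `x*` on `C([-h, 0]; V)`:
`⟨φ, x*⟩ = ∫_0^h φ(-θ) df(θ)` for all `φ`. -/
def Represents {h : ℝ} (f : Icc 0 h → StrongDual 𝕜 V)
    (x : StrongDual 𝕜 C(Icc (-h) 0, V)) : Prop :=
  ∀ φ : C(Icc (-h) 0, V),
    HasRSIntegral (fun θ : Icc 0 h => φ ⟨-θ, neg_le_neg θ.2.2, neg_nonpos.2 θ.2.1⟩) f (x φ)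

/-- `z ∈ V*` is the weak* Lebesgue integral over `s` of the `V*`-valued function `F`. -/
def HasWeakStarIntegral (F : ℝ → StrongDual 𝕜 V) (s : Set ℝ) (z : StrongDual 𝕜 V) : Prop :=
  ∀ v : V, IntegrableOn (fun θ => F θ v) s ∧ z v = ∫ θ in s, F θ v

end RiemannStieltjes

/-- `L¹([0, h]; W)`, Bochner integrable functions modulo equality almost everywhere. -/
abbrev L1Interval (W : Type*) [NormedAddCommGroup W] (h : ℝ) : Type _ :=
  Lp W 1 (volume.restrict (Icc (0 : ℝ) h))

section Translation

variable {W : Type*} [NormedAddCommGroup W] {h : ℝ}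

/-- Translation to the left over `t`, with extension by zero. -/
def leftTranslate (h : ℝ) (t : ℝ≥0) (g : ℝ → W) (θ : ℝ) : W :=
  if t + θ ≤ h then g (t + θ) else 0

theorem memLp_leftTranslate (t : ℝ≥0) (g : L1Interval W h) :
    MemLp (leftTranslate h t g) 1 (volume.restrict (Icc (0 : ℝ) h)) := by
  have h1 : MemLp ((Icc (0 : ℝ) h).indicator g) 1 volume :=
    (memLp_indicator_iff_restrict measurableSet_Icc).2 (Lp.memLp g)
  have h2 := (h1.comp_measurePreserving
    (measurePreserving_add_left volume (t : ℝ))).restrict (Icc (0 : ℝ) h)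
  refine h2.ae_eq ?_
  filter_upwards [ae_restrict_mem measurableSet_Icc] with θ hθ
  have h3 : (0 : ℝ) ≤ t + θ := add_nonneg t.2 hθ.1
  by_cases h4 : (t : ℝ) + θ ≤ h
  · simp [leftTranslate, h3, h4]
  · simp [leftTranslate, h4]

/-- The operator `T₁(t)` on `L¹([0, h]; W)`. -/
def translateL1 (t : ℝ≥0) (g : L1Interval W h) : L1Interval W h :=
  (memLp_leftTranslate t g).toLp

end Translation

/-- The function `t ↦ χ₀(t) y + ∫_0^t g(s) ds` on `[0, h]`, where `χ₀` is the characteristic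
function of `(0, h]`. -/
def iotaFun {W : Type*} [NormedAddCommGroup W] [NormedSpace ℝ W] {h : ℝ} (y : W)
    (g : L1Interval W h) (t : Icc 0 h) : W :=
  (Ioc (0 : ℝ) h).indicator (fun _ => y) t + ∫ s in (0 : ℝ)..t, g s

end

/-!
# The sun dual of the shift semigroup

A pair `(y, g)` of `y ∈ Y*` and `g ∈ L¹([0, h]; Y*)` acts on a history `φ ∈ C([-h, 0]; Y)` by
`φ ↦ ⟨φ(0), y⟩ + ∫_0^h ⟨φ(-θ), g(θ)⟩ dθ` (`pairFunctional`). The proof identifies the sun dual with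
the set of those functionals for which `y ∈ Y^⊙`.

*Norms.* A continuous selection of almost norming vectors for a continuous density, followed by
`L¹`-approximation of `g`, gives `‖(y, g)‖ = ‖y‖ + ‖g‖` (`norm_pairFunctional`); in particular the
range of `pairFunctional` is closed. Riemann-Stieltjes sums of `χ₀ y + ∫_0^· g` converge to
`pairFunctional` (`represents_iotaFun`), and since a functional is bounded by the variation of any
function representing it, the total variation is `‖y‖ + ‖g‖` as well.

*Action.* Splitting `∫_0^h ⟨(T₀(t)φ)(-θ), g(θ)⟩ dθ` at `θ = t` gives
`T₀*(t)(y, g) = (S*(t) y + ∫_0^{min(t,h)} S*(t - θ) g(θ) dθ, T₁(t) g)` (`adj_pairFunctional`).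
As translation is continuous in `L¹` and the weak* integral tends to `0` with `t`, every `(0, g)`
belongs to the sun dual, so that `(y, g)` does exactly when `y ∈ Y^⊙`
(`pairFunctional_mem_sunDual_iff`). Applied to `T₀*(t)(0, g)` this also shows that the weak*
integral lies in `Y^⊙`.

*Surjectivity.* An element `x` of the sun dual is the norm limit of its averages
`z = ∫ k(w) T₀*(w) x dw` with continuous kernels `k` concentrated to the right of `0`. If `φ(0) = 0`,
the average `∫ k(w) T₀(w)φ dw` is `θ ↦ ∫_0^h k(-θ - s) φ(-s) ds`, so that on such histories `z` has the
norm-continuous density `s ↦ ⟨k(-· - s) ⊗ ·, x⟩`; what remains of `z` depends on `φ(0)` only. Hence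
`z`, and by closedness also `x`, lies in the range of `pairFunctional`. No representation theorem
for the dual of `C([-h, 0]; Y)` is needed.

*Uniqueness of the representing function* (`IsNBV.eq_of_represents`) follows by testing with ramps
that drop from `1` to `0` immediately to the right of a given point.
-/

noncomputable section

/-! ### Functionals given by a vector and a density -/

section Pairing

variable {𝕜 Y : Type*} [RCLike 𝕜] [NormedAddCommGroup Y] [NormedSpace 𝕜 Y]

theorem MeasureTheory.AEStronglyMeasurable.strongDual_apply {α : Type*} [MeasurableSpace α]
    {μ : Measure α} {g : α → StrongDual 𝕜 Y} {f : α → Y} (hg : AEStronglyMeasurable g μ)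
    (hf : AEStronglyMeasurable f μ) : AEStronglyMeasurable (fun a => g a (f a)) μ :=
  (isBoundedBilinearMap_apply (𝕜 := 𝕜) (E := Y) (F := 𝕜)).continuous.comp_aestronglyMeasurable
    (hg.prodMk hf)

theorem MeasureTheory.Integrable.strongDual_apply {α : Type*} [MeasurableSpace α]
    {μ : Measure α} {g : α → StrongDual 𝕜 Y} {f : α → Y} {C : ℝ} (hg : Integrable g μ)
    (hf : AEStronglyMeasurable f μ) (hC : ∀ᵐ a ∂μ, ‖f a‖ ≤ C) :
    Integrable (fun a => g a (f a)) μ := by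
  refine (hg.norm.mul_const C).mono' (hg.1.strongDual_apply hf) ?_
  filter_upwards [hC] with a ha
  exact ((g a).le_opNorm _).trans (by gcongr)

theorem norm_integral_strongDual_apply_le {α : Type*} [MeasurableSpace α]
    {μ : Measure α} {g : α → StrongDual 𝕜 Y} {f : α → Y} {C : ℝ} (hg : Integrable g μ)
    (hC : ∀ᵐ a ∂μ, ‖f a‖ ≤ C) :
    ‖∫ a, g a (f a) ∂μ‖ ≤ (∫ a, ‖g a‖ ∂μ) * C := by
  rw [← integral_mul_const]
  refine norm_integral_le_of_norm_le (hg.norm.mul_const C) ?_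
  filter_upwards [hC] with a ha
  exact ((g a).le_opNorm _).trans (by gcongr)

variable {h : ℝ} (hh : 0 < h)

/-- The reflected history `θ ↦ φ(-θ)`, extended to all of `ℝ` by its end values. -/
def past (φ : C(Icc (-h) 0, Y)) (θ : ℝ) : Y := IccExtend (neg_nonpos.2 hh.le) φ (-θ)

theorem past_of_mem (φ : C(Icc (-h) 0, Y)) {θ : ℝ} (hθ : θ ∈ Icc 0 h) :
    past hh φ θ = φ ⟨-θ, neg_le_neg hθ.2, neg_nonpos.2 hθ.1⟩ :=
  IccExtend_of_mem _ _ _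

theorem continuous_past (φ : C(Icc (-h) 0, Y)) : Continuous (past hh φ) :=
  φ.continuous.Icc_extend'.comp continuous_neg

theorem norm_past_le (φ : C(Icc (-h) 0, Y)) (θ : ℝ) : ‖past hh φ θ‖ ≤ ‖φ‖ :=
  φ.norm_coe_le_norm _

theorem L1Interval.integrableOn {W : Type*} [NormedAddCommGroup W] (g : L1Interval W h) :
    IntegrableOn g (Icc 0 h) :=
  L1.integrable_coeFn g

theorem L1Interval.norm_def {W : Type*} [NormedAddCommGroup W] (g : L1Interval W h) :
    ‖g‖ = ∫ θ in Icc 0 h, ‖g θ‖ :=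
  L1.norm_eq_integral_norm g

theorem integrableOn_apply_past {g : ℝ → StrongDual 𝕜 Y} (hg : IntegrableOn g (Icc 0 h))
    (φ : C(Icc (-h) 0, Y)) : IntegrableOn (fun θ => g θ (past hh φ θ)) (Icc 0 h) :=
  hg.strongDual_apply (continuous_past hh φ).aestronglyMeasurable
    (ae_of_all _ (norm_past_le hh φ))

/-- The functional `φ ↦ ∫_0^h ⟨φ(-θ), g(θ)⟩ dθ` on the history space. -/
def integralFunctional :
    L1Interval (StrongDual 𝕜 Y) h →L[𝕜] StrongDual 𝕜 C(Icc (-h) 0, Y) :=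
  LinearMap.mkContinuous₂
    (LinearMap.mk₂ 𝕜 (fun (g : L1Interval (StrongDual 𝕜 Y) h) (φ : C(Icc (-h) 0, Y)) =>
        ∫ θ in Icc 0 h, g θ (past hh φ θ))
      (fun g₁ g₂ φ => by
        rw [← integral_add (integrableOn_apply_past hh g₁.integrableOn φ)
          (integrableOn_apply_past hh g₂.integrableOn φ)]
        refine integral_congr_ae ?_
        filter_upwards [Lp.coeFn_add g₁ g₂] with θ hθ
        rw [hθ]; rfl)
      (fun c g φ => by
        rw [← integral_smul]
        refine integral_congr_ae ?_
        filter_upwards [Lp.coeFn_smul c g] with θ hθ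
        rw [hθ]; rfl)
      (fun g φ₁ φ₂ => by
        rw [← integral_add (integrableOn_apply_past hh g.integrableOn φ₁)
          (integrableOn_apply_past hh g.integrableOn φ₂)]
        refine integral_congr_ae (ae_of_all _ fun θ => ?_)
        exact map_add (g θ) _ _)
      (fun c g φ => by
        rw [← integral_smul]
        refine integral_congr_ae (ae_of_all _ fun θ => ?_)
        exact map_smul (g θ) _ _)) 1
    (fun g φ => by
      rw [one_mul, g.norm_def]
      exact norm_integral_strongDual_apply_le g.integrableOn (ae_of_all _ (norm_past_le hh φ)))

theorem integralFunctional_apply (g : L1Interval (StrongDual 𝕜 Y) h) (φ : C(Icc (-h) 0, Y)) :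
    integralFunctional hh g φ = ∫ θ in Icc 0 h, g θ (past hh φ θ) := rfl

/-- The pair `(y, g)` acting on the history space by
`φ ↦ ⟨φ(0), y⟩ + ∫_0^h ⟨φ(-θ), g(θ)⟩ dθ`. -/
def pairFunctional : (StrongDual 𝕜 Y × L1Interval (StrongDual 𝕜 Y) h) →L[𝕜]
    StrongDual 𝕜 C(Icc (-h) 0, Y) :=
  (ContinuousLinearMap.precomp 𝕜
    (ContinuousMap.evalCLM 𝕜 (⟨0, neg_nonpos.2 hh.le, le_rfl⟩ : Icc (-h) 0))).coprod
    (integralFunctional hh)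

theorem pairFunctional_apply (y : StrongDual 𝕜 Y) (g : L1Interval (StrongDual 𝕜 Y) h)
    (φ : C(Icc (-h) 0, Y)) : pairFunctional hh (y, g) φ =
      y (φ ⟨0, neg_nonpos.2 hh.le, le_rfl⟩) + ∫ θ in Icc 0 h, g θ (past hh φ θ) := rfl

theorem norm_pairFunctional_le (y : StrongDual 𝕜 Y) (g : L1Interval (StrongDual 𝕜 Y) h) :
    ‖pairFunctional hh (y, g)‖ ≤ ‖y‖ + ‖g‖ := by
  refine ContinuousLinearMap.opNorm_le_bound _ (by positivity) fun φ => ?_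
  rw [pairFunctional_apply, add_mul]
  refine norm_add_le_of_le ?_ ?_
  · exact (y.le_opNorm _).trans (by gcongr; exact φ.norm_coe_le_norm _)
  · rw [g.norm_def]
    exact norm_integral_strongDual_apply_le g.integrableOn (ae_of_all _ (norm_past_le hh φ))

theorem StrongDual.exists_sub_lt_re_apply (f : StrongDual 𝕜 Y) {ε : ℝ} (hε : 0 < ε) :
    ∃ c : Y, ‖c‖ ≤ 1 ∧ ‖f‖ - ε < RCLike.re (f c) := by
  obtain ⟨x, hx, hfx⟩ := f.exists_lt_apply_of_lt_opNorm (sub_lt_self ‖f‖ hε)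
  obtain ⟨u, hu, hux⟩ := RCLike.exists_norm_eq_mul_self (f x)
  refine ⟨u • x, by rw [norm_smul, hu, one_mul]; exact hx.le, ?_⟩
  rw [map_smul, smul_eq_mul, ← hux, RCLike.ofReal_re]
  exact hfx

/-- A continuous selection of almost norming vectors, with the value at `0` almost norming `y`.
Near `0` the two requirements may conflict, so the one on `g` is dropped there. -/
theorem exists_almost_norming (y : StrongDual 𝕜 Y) {g : ℝ → StrongDual 𝕜 Y} (hg : Continuous g)
    {ε δ : ℝ} (hε : 0 < ε) (hδ : 0 < δ) :
    ∃ φ : C(Icc (-h) 0, Y), ‖φ‖ ≤ 1 ∧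
      ‖y‖ - ε ≤ RCLike.re (y (φ ⟨0, neg_nonpos.2 hh.le, le_rfl⟩)) ∧
      ∀ θ ∈ Icc 0 h, δ ≤ θ → ‖g θ‖ - ε ≤ RCLike.re (g θ (past hh φ θ)) := by
  let : NormedSpace ℝ Y := NormedSpace.restrictScalars ℝ 𝕜 Y
  let t : Icc (-h) 0 → Set Y := fun s => {c | ‖c‖ ≤ 1 ∧
    ((s : ℝ) = 0 → ‖y‖ - ε ≤ RCLike.re (y c)) ∧
    ((s : ℝ) ≤ -δ → ‖g (-s)‖ - ε ≤ RCLike.re (g (-s) c))}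
  have hconv (f : StrongDual 𝕜 Y) (r : ℝ) : Convex ℝ {c : Y | r ≤ RCLike.re (f c)} := by
    intro a ha b hb p q hp hq hpq
    have e : RCLike.re (f (p • a + q • b)) = p * RCLike.re (f a) + q * RCLike.re (f b) := by
      rw [map_add, f.map_smul_of_tower, f.map_smul_of_tower, map_add, RCLike.smul_re, RCLike.smul_re]
    simp only [mem_ofPred_eq] at *
    rw [e]
    calc r = p * r + q * r := by rw [← add_mul, hpq, one_mul]
      _ ≤ _ := by gcongr
  have ht : ∀ s, Convex ℝ (t s) := by
    intro s
    have h1 : Convex ℝ {c : Y | ‖c‖ ≤ 1} := by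
      simpa [Metric.closedBall, dist_eq_norm] using convex_closedBall (0 : Y) 1
    intro a ha b hb p q hp hq hpq
    exact ⟨h1 ha.1 hb.1 hp hq hpq,
      fun hs => hconv _ _ (ha.2.1 hs) (hb.2.1 hs) hp hq hpq,
      fun hs => hconv _ _ (ha.2.2 hs) (hb.2.2 hs) hp hq hpq⟩
  have hloc : ∀ s : Icc (-h) 0, ∃ c : Y, ∀ᶠ r in 𝓝 s, c ∈ t r := by
    intro s
    rcases eq_or_lt_of_le s.2.2 with h0 | h0
    · obtain ⟨c, hc, hyc⟩ := y.exists_sub_lt_re_apply hε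
      refine ⟨c, ?_⟩
      have : ∀ᶠ r : Icc (-h) 0 in 𝓝 s, -δ < (r : ℝ) :=
        continuous_subtype_val.continuousAt.eventually_const_lt (by rw [h0]; linarith)
      filter_upwards [this] with r hr
      exact ⟨hc, fun _ => hyc.le, fun hr' => absurd hr' (not_le.2 hr)⟩
    · obtain ⟨c, hc, hgc⟩ := (g (-s)).exists_sub_lt_re_apply hε
      refine ⟨c, ?_⟩
      have h1 : ∀ᶠ r : Icc (-h) 0 in 𝓝 s, (r : ℝ) < 0 :=
        continuous_subtype_val.continuousAt.eventually_lt_const h0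
      have h2 : ∀ᶠ r : Icc (-h) 0 in 𝓝 s, ‖g (-r)‖ - ε < RCLike.re (g (-r) c) := by
        have hc1 : Continuous fun r : Icc (-h) 0 => g (-r) := by fun_prop
        refine ContinuousAt.eventually_lt (f := fun r : Icc (-h) 0 => ‖g (-r)‖ - ε)
          (g := fun r : Icc (-h) 0 => RCLike.re (g (-r) c)) ?_ ?_ hgc
        · exact (hc1.norm.sub continuous_const).continuousAt
        · exact (RCLike.continuous_re.comp (hc1.clm_apply continuous_const)).continuousAt
      filter_upwards [h1, h2] with r hr1 hr2
      exact ⟨hc, fun hr => absurd hr hr1.ne, fun _ => hr2.le⟩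
  obtain ⟨φ, hφ⟩ := exists_continuous_forall_mem_convex_of_local_const ht hloc
  refine ⟨φ, ?_, (hφ _).2.1 rfl, fun θ hθ hδθ => ?_⟩
  · exact (ContinuousMap.norm_le _ zero_le_one).2 fun s => (hφ s).1
  · have := (hφ ⟨-θ, neg_le_neg hθ.2, neg_nonpos.2 hθ.1⟩).2.2 (neg_le_neg hδθ)
    rw [past_of_mem hh φ hθ]
    simpa only [neg_neg] using this

/-- The interval `[0, δ)` on which the almost norming selection ignores `g` is short enough that
its contribution to the integral, at most `2 C δ` for a bound `C` of `‖g‖`, is negligible. -/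
theorem exists_almost_norming_integral (y : StrongDual 𝕜 Y) {g : ℝ → StrongDual 𝕜 Y}
    (hg : Continuous g) {ε : ℝ} (hε : 0 < ε) :
    ∃ φ : C(Icc (-h) 0, Y), ‖φ‖ ≤ 1 ∧
      ‖y‖ + (∫ θ in Icc 0 h, ‖g θ‖) - ε ≤
        RCLike.re (y (φ ⟨0, neg_nonpos.2 hh.le, le_rfl⟩) +
          ∫ θ in Icc 0 h, g θ (past hh φ θ)) := by
  obtain ⟨C, hC⟩ := isCompact_Icc.exists_bound_of_continuousOn (s := Icc 0 h) hg.continuousOn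
  have hC0 : 0 ≤ C := (norm_nonneg _).trans (hC 0 ⟨le_rfl, hh.le⟩)
  set η : ℝ := ε / (2 + h) with hη
  have hη0 : 0 < η := by positivity
  set δ : ℝ := η / (2 * C + 1) with hδ
  have hδ0 : 0 < δ := by positivity
  obtain ⟨φ, hφ1, hφ2, hφ3⟩ := exists_almost_norming hh y hg hη0 hδ0
  refine ⟨φ, hφ1, ?_⟩
  have hgi : IntegrableOn g (Icc 0 h) := hg.continuousOn.integrableOn_Icc
  have hind : IntegrableOn ((Iio δ).indicator fun _ : ℝ => 2 * C) (Icc 0 h) :=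
    (integrable_const _).indicator measurableSet_Iio
  have h1 : ∫ θ in Icc 0 h, (Iio δ).indicator (fun _ : ℝ => 2 * C) θ ≤ η := by
    rw [setIntegral_indicator measurableSet_Iio, setIntegral_const, smul_eq_mul]
    have : volume.real (Icc 0 h ∩ Iio δ) ≤ δ := by
      calc volume.real (Icc 0 h ∩ Iio δ) ≤ volume.real (Icc 0 δ) := by
            refine measureReal_mono (fun x hx => ⟨hx.1.1, (mem_Iio.1 hx.2).le⟩) (by simp)
        _ = δ := by simp [hδ0.le]
    calc _ ≤ δ * (2 * C) := by gcongr
      _ ≤ δ * (2 * C + 1) := by gcongr; linarith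
      _ = η := by rw [hδ]; field_simp
  have h2 : ∫ θ in Icc 0 h, (‖g θ‖ - η - (Iio δ).indicator (fun _ : ℝ => 2 * C) θ) ≤
      ∫ θ in Icc 0 h, RCLike.re (g θ (past hh φ θ)) := by
    refine setIntegral_mono_on ((hgi.norm.sub (integrable_const _)).sub hind)
      (integrableOn_apply_past hh hgi φ).re measurableSet_Icc fun θ hθ => ?_
    by_cases hθδ : θ < δ
    · rw [indicator_of_mem (mem_Iio.2 hθδ)]
      have h3 : |RCLike.re (g θ (past hh φ θ))| ≤ C := by
        refine (RCLike.abs_re_le_norm _).trans (((g θ).le_opNorm _).trans ?_)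
        calc ‖g θ‖ * ‖past hh φ θ‖ ≤ C * 1 := by
              gcongr
              · exact hC θ hθ
              · exact (norm_past_le hh φ θ).trans hφ1
          _ = C := mul_one C
      linarith [(abs_le.1 h3).1, hC θ hθ]
    · rw [indicator_of_notMem (by simpa using hθδ), sub_zero]
      exact hφ3 θ hθ (not_lt.1 hθδ)
  have h0 : IntegrableOn (fun θ => ‖g θ‖ - η) (Icc 0 h) := hgi.norm.sub (integrable_const _)
  rw [integral_sub h0 hind, integral_sub hgi.norm (integrable_const _)] at h2
  have h4 : ∫ _ in Icc 0 h, η = h * η := by simp [hh.le]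
  rw [h4] at h2
  rw [map_add]
  have h5 : RCLike.re (∫ θ in Icc 0 h, g θ (past hh φ θ)) =
      ∫ θ in Icc 0 h, RCLike.re (g θ (past hh φ θ)) :=
    (integral_re (integrableOn_apply_past hh hgi φ)).symm
  rw [h5]
  have h6 : ε = (2 + h) * η := by rw [hη]; field_simp
  linarith

/-- The norm of a functional is the sum of the norms of `y` and `g`, by approximation of `g` with
continuous densities. -/
theorem norm_pairFunctional (y : StrongDual 𝕜 Y) (g : L1Interval (StrongDual 𝕜 Y) h) :
    ‖pairFunctional hh (y, g)‖ = ‖y‖ + ‖g‖ := by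
  refine le_antisymm (norm_pairFunctional_le hh y g) (le_of_forall_pos_le_add fun ε hε => ?_)
  obtain ⟨g', -, hgg', hg'c, hg'i⟩ :=
    g.integrableOn.exists_hasCompactSupport_integral_sub_le (ε := ε / 3) (by positivity)
  have hg'i : IntegrableOn g' (Icc 0 h) := hg'i
  obtain ⟨φ, hφ, hre⟩ := exists_almost_norming_integral hh y hg'c (ε := ε / 3) (by positivity)
  have hgi := g.integrableOn
  have h1 : ‖(∫ θ in Icc 0 h, g θ (past hh φ θ)) - ∫ θ in Icc 0 h, g' θ (past hh φ θ)‖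
      ≤ ε / 3 := by
    rw [← integral_sub (integrableOn_apply_past hh hgi φ) (integrableOn_apply_past hh hg'i φ)]
    refine (norm_integral_strongDual_apply_le (g := fun θ => g θ - g' θ) (hgi.sub hg'i)
      (ae_of_all _ fun θ => (norm_past_le hh φ θ).trans hφ)).trans ?_
    rw [mul_one]
    exact hgg'
  have h2 : (∫ θ in Icc 0 h, ‖g θ‖) - (∫ θ in Icc 0 h, ‖g' θ‖) ≤ ε / 3 := by
    rw [← integral_sub hgi.norm hg'i.norm]
    refine (integral_mono (hgi.norm.sub hg'i.norm) (hgi.sub hg'i).norm fun θ => ?_).trans hgg'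
    exact norm_sub_norm_le _ _
  have h3 : RCLike.re (pairFunctional hh (y, g) φ) ≤ ‖pairFunctional hh (y, g)‖ := by
    refine (RCLike.re_le_norm _).trans ((ContinuousLinearMap.le_opNorm _ _).trans ?_)
    exact mul_le_of_le_one_right (norm_nonneg _) hφ
  rw [pairFunctional_apply, map_add] at h3
  rw [map_add] at hre
  have h4 := (RCLike.abs_re_le_norm _).trans h1
  rw [map_sub] at h4
  rw [g.norm_def]
  linarith [(abs_le.1 h4).1]

/-- A linear map that is isometric for the sum norm on the product is bounded below and above for
the maximum norm. -/
theorem isClosed_range_of_norm_eq_add {E F G : Type*} [NormedAddCommGroup E] [NormedAddCommGroup F]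
    [NormedAddCommGroup G] [CompleteSpace E] [CompleteSpace F] (f : E × F → G)
    (hadd : ∀ p q, f (p + q) = f p + f q) (hf : ∀ a b, ‖f (a, b)‖ = ‖a‖ + ‖b‖) :
    IsClosed (range f) := by
  let f' : E × F →+ G := AddMonoidHom.mk' f hadd
  have h1 : AntilipschitzWith 1 f' :=
    AddMonoidHomClass.antilipschitz_of_bound f' fun p => by
      change ‖p‖ ≤ (1 : ℝ≥0) * ‖f (p.1, p.2)‖
      rw [NNReal.coe_one, one_mul, hf, Prod.norm_def]
      exact max_le (le_add_of_nonneg_right (norm_nonneg _)) (le_add_of_nonneg_left (norm_nonneg _))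
  have h2 : LipschitzWith 2 f' :=
    AddMonoidHomClass.lipschitz_of_bound_nnnorm f' 2 fun p => by
      rw [← NNReal.coe_le_coe]
      change ‖f (p.1, p.2)‖ ≤ 2 * ‖p‖
      rw [hf, two_mul]
      exact add_le_add (norm_fst_le p) (norm_snd_le p)
  exact h1.isClosed_range h2.uniformContinuous

theorem isClosed_range_pairFunctional :
    IsClosed (range (pairFunctional (𝕜 := 𝕜) (Y := Y) hh)) :=
  isClosed_range_of_norm_eq_add (pairFunctional (𝕜 := 𝕜) (Y := Y) hh)
    (fun p q => map_add (pairFunctional hh) p q) (norm_pairFunctional hh)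

end Pairing

/-! ### Riemann-Stieltjes representation along uniform partitions -/

section UniformPartition

variable {h : ℝ} (hh : 0 < h)

/-- The `j`-th of the `N + 1` equally spaced points of `[0, h]`; constantly `h` for `j > N`. -/
def gridPoint (N j : ℕ) : Icc 0 h := projIcc 0 h hh.le (j * (h / N))

theorem coe_gridPoint {N j : ℕ} (hN : N ≠ 0) (hj : j ≤ N) :
    (gridPoint hh N j : ℝ) = j * (h / N) := by
  have hN' : (0 : ℝ) < N := by positivity
  have h1 : (j : ℝ) * (h / N) ≤ h := by
    calc (j : ℝ) * (h / N) ≤ N * (h / N) := by gcongr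
      _ = h := by field_simp
  rw [gridPoint, projIcc_of_mem hh.le ⟨by positivity, h1⟩]

theorem monotone_gridPoint (N : ℕ) : Monotone (gridPoint hh N) := fun i j hij =>
  monotone_projIcc hh.le (by gcongr)

theorem gridPoint_zero (N : ℕ) : gridPoint hh N 0 = ⟨0, le_rfl, hh.le⟩ := by
  simp [gridPoint, projIcc_left]

theorem gridPoint_self {N : ℕ} (hN : N ≠ 0) : gridPoint hh N N = ⟨h, hh.le, le_rfl⟩ := by
  apply Subtype.ext
  rw [coe_gridPoint hh hN le_rfl]
  field_simp

/-- The partition of `[0, h]` into `N` equal parts, with left endpoints as sample points. -/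
def uniformPartition (N : ℕ) (hN : N ≠ 0) : TaggedPartition 0 h where
  N := N
  pt j := gridPoint hh N j
  strictMono_pt i j hij := by
    rw [← Subtype.coe_lt_coe, coe_gridPoint hh hN (by omega), coe_gridPoint hh hN (by omega)]
    have : (0 : ℝ) < h / N := by positivity
    gcongr
    exact hij
  pt_zero := by simp [gridPoint_zero]
  pt_last := by simp [gridPoint_self hh hN]
  tag j := gridPoint hh N j
  le_tag j := le_rfl
  tag_le j := monotone_gridPoint hh N (by simp)

theorem meshLE_uniformPartition (N : ℕ) (hN : N ≠ 0) :
    (uniformPartition hh N hN).MeshLE (h / N) := by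
  intro j
  have hj : (j : ℕ) < N := j.2
  change (gridPoint hh N (j.succ : Fin (N + 1)) : ℝ) -
    gridPoint hh N (j.castSucc : Fin (N + 1)) ≤ h / N
  rw [Fin.val_succ, Fin.val_castSucc, coe_gridPoint hh hN hj, coe_gridPoint hh hN hj.le]
  push_cast
  linarith

variable {𝕜 V : Type*} [RCLike 𝕜] [NormedAddCommGroup V] [NormedSpace 𝕜 V]

/-- A Riemann-Stieltjes integral is the limit of the sums over the uniform partitions. -/
theorem HasRSIntegral.tendsto_gridPoint {f : Icc 0 h → V} {η : Icc 0 h → StrongDual 𝕜 V} {z : 𝕜}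
    (H : HasRSIntegral f η z) :
    Tendsto (fun N : ℕ => ∑ j ∈ Finset.range N,
      (η (gridPoint hh N (j + 1)) - η (gridPoint hh N j)) (f (gridPoint hh N j)))
      atTop (𝓝 z) := by
  rw [Metric.tendsto_atTop]
  intro ε hε
  obtain ⟨δ, hδ, hP⟩ := H (ε / 2) (by positivity)
  obtain ⟨N₀, hN₀⟩ := exists_nat_gt (h / δ)
  refine ⟨max N₀ 1, fun N hN => ?_⟩
  have hN1 : N ≠ 0 := by have := le_trans (le_max_right _ _) hN; omega
  have hNp : (0 : ℝ) < N := by positivity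
  have hNδ : h / N ≤ δ := by
    have : (N₀ : ℝ) ≤ N := by exact_mod_cast le_trans (le_max_left _ _) hN
    rw [div_le_iff₀ hNp, mul_comm, ← div_le_iff₀ hδ]
    linarith
  have h1 := hP (uniformPartition hh N hN1)
    (fun j => (meshLE_uniformPartition hh N hN1 j).trans hNδ)
  rw [dist_eq_norm, Finset.sum_range]
  exact lt_of_le_of_lt h1 (by linarith)

end UniformPartition

section Representation

variable {𝕜 Y : Type*} [RCLike 𝕜] [NormedAddCommGroup Y] [NormedSpace 𝕜 Y] {h : ℝ}

theorem ofReal_norm_le_eVariationOn_of_represents (hh : 0 < h) {f : Icc 0 h → StrongDual 𝕜 Y}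
    {x : StrongDual 𝕜 C(Icc (-h) 0, Y)} (H : Represents f x) :
    ENNReal.ofReal ‖x‖ ≤ eVariationOn f univ := by
  by_cases hV : eVariationOn f univ = ⊤
  · rw [hV]; exact le_top
  rw [← ENNReal.ofReal_toReal hV]
  refine ENNReal.ofReal_le_ofReal (x.opNorm_le_bound ENNReal.toReal_nonneg fun φ => ?_)
  refine le_of_tendsto ((H φ).tendsto_gridPoint hh).norm (Eventually.of_forall fun N => ?_)
  have h1 : ∑ j ∈ Finset.range N, ‖f (gridPoint hh N (j + 1)) - f (gridPoint hh N j)‖ ≤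
      (eVariationOn f univ).toReal := by
    have h2 := eVariationOn.sum_le (f := f) (n := N) (monotone_gridPoint hh N)
      (fun _ => mem_univ _)
    have h3 : ∑ j ∈ Finset.range N, edist (f (gridPoint hh N (j + 1))) (f (gridPoint hh N j)) =
        ENNReal.ofReal
          (∑ j ∈ Finset.range N, ‖f (gridPoint hh N (j + 1)) - f (gridPoint hh N j)‖) := by
      rw [ENNReal.ofReal_sum_of_nonneg fun _ _ => norm_nonneg _]
      exact Finset.sum_congr rfl fun _ _ => by rw [edist_dist, dist_eq_norm]
    rw [h3] at h2
    exact (ENNReal.ofReal_le_iff_le_toReal hV).1 h2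
  calc _ ≤ ∑ j ∈ Finset.range N,
        ‖f (gridPoint hh N (j + 1)) - f (gridPoint hh N j)‖ * ‖φ‖ := by
        refine norm_sum_le_of_le _ fun j _ => (ContinuousLinearMap.le_opNorm _ _).trans ?_
        gcongr
        exact φ.norm_coe_le_norm _
    _ ≤ _ := by
        rw [← Finset.sum_mul]
        gcongr

/-- Summation by parts. -/
theorem sum_range_sub_mul_eq {R : Type*} [CommRing R] (a p : ℕ → R) (N : ℕ) :
    ∑ j ∈ Finset.range N, (a (j + 1) - a j) * p j =
      a N * p N - a 0 * p 0 + ∑ j ∈ Finset.range N, a (j + 1) * (p j - p (j + 1)) := by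
  induction N with
  | zero => simp
  | succ N ih => rw [Finset.sum_range_succ, ih, Finset.sum_range_succ]; ring

/-- A weighted average: a sequence that stays close to `b` wherever the decreasing sequence `p`
drops is, after summation by parts, close to `b`. -/
theorem norm_sum_range_sub_mul_sub_le {a : ℕ → 𝕜} {p : ℕ → ℝ} {N : ℕ} {b : 𝕜} {ε : ℝ}
    (ha : a 0 = 0) (hp0 : p 0 = 1) (hpN : p N = 0) (hanti : Antitone p)
    (hb : ∀ j < N, p (j + 1) < p j → ‖a (j + 1) - b‖ ≤ ε) :
    ‖∑ j ∈ Finset.range N, (a (j + 1) - a j) * (p j : 𝕜) - b‖ ≤ ε := by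
  have h1 : ∑ j ∈ Finset.range N, (p j - p (j + 1)) = 1 := by
    rw [Finset.sum_range_sub', hp0, hpN, sub_zero]
  have h2 : b = ∑ j ∈ Finset.range N, b * ((p j : 𝕜) - (p (j + 1) : 𝕜)) := by
    rw [← Finset.mul_sum]
    simp only [← RCLike.ofReal_sub]
    rw [← RCLike.ofReal_sum, h1, RCLike.ofReal_one, mul_one]
  have h3 := sum_range_sub_mul_eq a (fun j => (p j : 𝕜)) N
  rw [h3, ha, hpN, RCLike.ofReal_zero, mul_zero, zero_mul, sub_zero, zero_add]
  nth_rewrite 1 [h2]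
  rw [← Finset.sum_sub_distrib]
  calc _ ≤ ∑ j ∈ Finset.range N, ε * (p j - p (j + 1)) := by
        refine norm_sum_le_of_le _ fun j hj => ?_
        have h4 : 0 ≤ p j - p (j + 1) := sub_nonneg.2 (hanti (Nat.le_succ j))
        rw [← sub_mul, ← RCLike.ofReal_sub, norm_mul, RCLike.norm_ofReal, abs_of_nonneg h4]
        rcases h4.eq_or_lt with h5 | h5
        · rw [← h5]; simp
        · gcongr
          exact hb j (Finset.mem_range.1 hj) (sub_pos.1 h5)
    _ = ε := by rw [← Finset.mul_sum, h1, mul_one]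

/-- The function equal to `1` up to `t`, to `0` from `t + δ` on, and affine in between. -/
def ramp (t δ s : ℝ) : ℝ := max 0 (min 1 ((t + δ - s) / δ))

theorem continuous_ramp (t δ : ℝ) : Continuous (ramp t δ) := by
  unfold ramp; fun_prop

theorem antitone_ramp (t : ℝ) {δ : ℝ} (hδ : 0 < δ) : Antitone (ramp t δ) := by
  intro a b hab
  unfold ramp
  gcongr

theorem ramp_of_le {t δ s : ℝ} (hδ : 0 < δ) (hs : s ≤ t) : ramp t δ s = 1 := by
  have : 1 ≤ (t + δ - s) / δ := by rw [le_div_iff₀ hδ]; linarith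
  simp [ramp, min_eq_left this]

theorem ramp_of_ge {t δ s : ℝ} (hδ : 0 < δ) (hs : t + δ ≤ s) : ramp t δ s = 0 := by
  have : (t + δ - s) / δ ≤ 0 := div_nonpos_of_nonpos_of_nonneg (by linarith) hδ.le
  exact max_eq_left ((min_le_right _ _).trans this)

/-- A function vanishing at `0` and right-continuous on `(0, h)` that represents the zero
functional vanishes: testing against ramps that drop from `1` to `0` just to the right of `t`
recovers its value at `t`. -/
theorem eq_zero_of_represents_zero (hh : 0 < h) {f : Icc 0 h → StrongDual 𝕜 Y}
    (H : Represents f 0) (h0 : ∀ t : Icc 0 h, (t : ℝ) = 0 → f t = 0)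
    (hr : ∀ t : Icc 0 h, 0 < (t : ℝ) → (t : ℝ) < h → ContinuousWithinAt f (Ici t) t) :
    f = 0 := by
  funext t
  rcases t.2.1.eq_or_lt with ht0 | ht0
  · exact h0 t ht0.symm
  rcases t.2.2.eq_or_lt with hth | hth
  · ext v
    have h1 := (H (ContinuousMap.const _ v)).tendsto_gridPoint hh
    refine tendsto_nhds_unique (Tendsto.congr' ?_ tendsto_const_nhds) h1
    filter_upwards [eventually_ne_atTop 0] with N hN
    simp only [ContinuousMap.const_apply, sub_apply]
    rw [Finset.sum_range_sub (fun j => f (gridPoint hh N j) v), gridPoint_zero,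
      gridPoint_self hh hN, h0 ⟨0, le_rfl, hh.le⟩ rfl]
    have : t = ⟨h, hh.le, le_rfl⟩ := Subtype.ext hth
    rw [this]
    simp
  · ext v
    rw [Pi.zero_apply, zero_apply, ← norm_le_zero_iff]
    refine le_of_forall_pos_le_add fun ε hε => ?_
    rw [zero_add]
    have hcont : ContinuousWithinAt (fun s => f s v) (Ici t) t :=
      (ContinuousLinearMap.apply 𝕜 𝕜 v).continuous.continuousAt.comp_continuousWithinAt
        (hr t ht0 hth)
    obtain ⟨ρ, hρ, hρε⟩ := Metric.continuousWithinAt_iff.1 hcont ε hε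
    -- steps of length below `ρ / 2` and a ramp of width at most `ρ / 2` keep every point where the
    -- ramp drops within `ρ` of `t`; the ramp reaches `0` before `h`
    set δ := min (ρ / 2) (h - t) with hδ
    have hδ0 : 0 < δ := lt_min (by positivity) (by linarith)
    have hδh : (t : ℝ) + δ ≤ h := by have := min_le_right (ρ / 2) (h - t); linarith
    let φ : C(Icc (-h) 0, Y) :=
      ⟨fun s => (ramp t δ (-s) : 𝕜) • v, by
        have := continuous_ramp t δ
        fun_prop⟩
    have h1 := ((H φ).tendsto_gridPoint hh).sub_const (f t v)
    rw [zero_apply, zero_sub] at h1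
    rw [← norm_neg]
    refine le_of_tendsto h1.norm ?_
    obtain ⟨N₀, hN₀⟩ := exists_nat_gt (h / (ρ / 2))
    filter_upwards [eventually_ne_atTop 0, eventually_ge_atTop N₀] with N hN hNN₀
    have hNp : (0 : ℝ) < N := by positivity
    have hstep : h / N < ρ / 2 := by
      have : (N₀ : ℝ) ≤ N := by exact_mod_cast hNN₀
      rw [div_lt_iff₀ hNp, mul_comm, ← div_lt_iff₀ (by positivity)]
      linarith
    have h2 : ∀ j, (f (gridPoint hh N (j + 1)) - f (gridPoint hh N j))
        (φ ⟨-(gridPoint hh N j : ℝ), neg_le_neg (gridPoint hh N j).2.2,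
          neg_nonpos.2 (gridPoint hh N j).2.1⟩) =
        (f (gridPoint hh N (j + 1)) v - f (gridPoint hh N j) v) *
          ((ramp t δ (gridPoint hh N j) : ℝ) : 𝕜) := by
      intro j
      simp only [φ, ContinuousMap.coe_mk, neg_neg, map_smul, smul_eq_mul,
        sub_apply]
      ring
    simp only [h2]
    refine norm_sum_range_sub_mul_sub_le (a := fun j => f (gridPoint hh N j) v)
      (p := fun j => ramp t δ (gridPoint hh N j)) ?_ ?_ ?_ ?_ ?_
    · simp only [gridPoint_zero]
      rw [h0 ⟨0, le_rfl, hh.le⟩ rfl]; rfl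
    · simp only [gridPoint_zero]
      exact ramp_of_le hδ0 ht0.le
    · simp only [gridPoint_self hh hN]
      exact ramp_of_ge hδ0 hδh
    · exact (antitone_ramp t hδ0).comp_monotone
        ((Subtype.mono_coe _).comp (monotone_gridPoint hh N))
    · intro j hj hlt
      have e1 := coe_gridPoint hh hN hj.le
      have e2 := coe_gridPoint hh hN (Nat.succ_le_of_lt hj)
      push_cast at e2
      have h3 : (t : ℝ) < gridPoint hh N (j + 1) := by
        by_contra hcon
        have hcon := not_lt.1 hcon
        have : (gridPoint hh N j : ℝ) ≤ gridPoint hh N (j + 1) :=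
          monotone_gridPoint hh N (Nat.le_succ j)
        simp only [ramp_of_le hδ0 hcon, ramp_of_le hδ0 (this.trans hcon), lt_irrefl] at hlt
      have h4 : (gridPoint hh N j : ℝ) < t + δ := by
        by_contra hcon
        have hcon := not_lt.1 hcon
        have : (gridPoint hh N j : ℝ) ≤ gridPoint hh N (j + 1) :=
          monotone_gridPoint hh N (Nat.le_succ j)
        simp only [ramp_of_ge hδ0 hcon, ramp_of_ge hδ0 (hcon.trans this), lt_irrefl] at hlt
      have h5 := min_le_left (ρ / 2) (h - t)
      have h6 : dist (gridPoint hh N (j + 1)) t < ρ := by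
        rw [Subtype.dist_eq, Real.dist_eq, abs_of_pos (by linarith)]
        linarith
      rw [← dist_eq_norm]
      exact (hρε (show t ≤ gridPoint hh N (j + 1) from h3.le) h6).le

theorem HasRSIntegral.sub_integrator {V : Type*} [NormedAddCommGroup V] [NormedSpace 𝕜 V] {a b : ℝ}
    {f : Icc a b → V} {η₁ η₂ : Icc a b → StrongDual 𝕜 V} {z₁ z₂ : 𝕜}
    (H₁ : HasRSIntegral f η₁ z₁) (H₂ : HasRSIntegral f η₂ z₂) :
    HasRSIntegral f (η₁ - η₂) (z₁ - z₂) := by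
  intro ε hε
  obtain ⟨δ₁, hδ₁, h₁⟩ := H₁ (ε / 2) (by positivity)
  obtain ⟨δ₂, hδ₂, h₂⟩ := H₂ (ε / 2) (by positivity)
  refine ⟨min δ₁ δ₂, lt_min hδ₁ hδ₂, fun P hP => ?_⟩
  have h3 : rsSum f (η₁ - η₂) P = rsSum f η₁ P - rsSum f η₂ P := by
    unfold rsSum
    rw [← Finset.sum_sub_distrib]
    refine Finset.sum_congr rfl fun j _ => ?_
    simp only [Pi.sub_apply, sub_apply]
    ring
  calc ‖rsSum f (η₁ - η₂) P - (z₁ - z₂)‖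
      = ‖(rsSum f η₁ P - z₁) - (rsSum f η₂ P - z₂)‖ := by rw [h3]; congr 1; ring
    _ ≤ ε / 2 + ε / 2 := norm_sub_le_of_le
        (h₁ P fun j => (hP j).trans (min_le_left _ _))
        (h₂ P fun j => (hP j).trans (min_le_right _ _))
    _ = ε := by ring

theorem IsNBV.eq_of_represents (hh : 0 < h) {f₁ f₂ : Icc 0 h → StrongDual 𝕜 Y}
    {x : StrongDual 𝕜 C(Icc (-h) 0, Y)} (hf₁ : IsNBV f₁) (hf₂ : IsNBV f₂)
    (H₁ : Represents f₁ x) (H₂ : Represents f₂ x) : f₁ = f₂ := by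
  rw [← sub_eq_zero]
  refine eq_zero_of_represents_zero hh (fun φ => ?_) (fun t ht => ?_) fun t ht0 hth =>
    (hf₁.right_continuous t ht0 hth).sub (hf₂.right_continuous t ht0 hth)
  · have := (H₁ φ).sub_integrator (H₂ φ)
    rwa [sub_self] at this
  · rw [Pi.sub_apply, hf₁.map_zero t ht, hf₂.map_zero t ht, sub_zero]

end Representation

/-! ### The functions `χ₀ y + ∫_0^· g` -/

section IotaFun

variable {h : ℝ}

theorem L1Interval.intervalIntegrable {W : Type*} [NormedAddCommGroup W] (g : L1Interval W h)
    {a b : ℝ} (ha : a ∈ Icc 0 h) (hb : b ∈ Icc 0 h) : IntervalIntegrable g volume a b :=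
  (g.integrableOn.mono_set (ordConnected_Icc.uIcc_subset ha hb)).intervalIntegrable

theorem iotaFun_sub_iotaFun {W : Type*} [NormedAddCommGroup W] [NormedSpace ℝ W] (y : W)
    (g : L1Interval W h) (s t : Icc 0 h) :
    iotaFun y g t - iotaFun y g s =
      ((Ioc (0 : ℝ) h).indicator (fun _ => y) (t : ℝ) -
        (Ioc (0 : ℝ) h).indicator (fun _ => y) (s : ℝ)) + ∫ θ in (s : ℝ)..t, g θ := by
  have h0 : (0 : ℝ) ∈ Icc 0 h := ⟨le_rfl, t.2.1.trans t.2.2⟩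
  rw [iotaFun, iotaFun, add_sub_add_comm, intervalIntegral.integral_interval_sub_left
    (g.intervalIntegrable h0 t.2) (g.intervalIntegrable h0 s.2)]

theorem Fin.sum_univ_succ_sub_castSucc {M : Type*} [AddCommGroup M] {n : ℕ} (F : Fin (n + 1) → M) :
    ∑ j : Fin n, (F j.succ - F j.castSucc) = F (Fin.last n) - F 0 := by
  induction n with
  | zero => simp
  | succ n ih =>
    rw [Fin.sum_univ_castSucc]
    have := ih fun j => F j.castSucc
    simp only [Fin.castSucc_zero] at this
    simp only [← Fin.castSucc_succ] at this ⊢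
    rw [this, Fin.succ_last]
    abel

variable {𝕜 Y : Type*} [RCLike 𝕜] [NormedAddCommGroup Y] [NormedSpace 𝕜 Y] (hh : 0 < h)

/-- In a Riemann-Stieltjes sum for `χ₀ y` only the first interval contributes. -/
theorem sum_indicator_increments_apply (y : StrongDual 𝕜 Y) (P : TaggedPartition 0 h)
    (hN : 0 < P.N) (f : Icc 0 h → Y) :
    ∑ j : Fin P.N, ((Ioc (0 : ℝ) h).indicator (fun _ => y) (P.pt j.succ : ℝ) -
      (Ioc (0 : ℝ) h).indicator (fun _ => y) (P.pt j.castSucc : ℝ)) (f (P.tag j)) =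
      y (f (P.tag ⟨0, hN⟩)) := by
  have hpos : ∀ j : Fin (P.N + 1), 0 < j → (P.pt j : ℝ) ∈ Ioc 0 h := fun j hj => by
    have : (P.pt 0 : ℝ) < P.pt j := P.strictMono_pt hj
    rw [P.pt_zero] at this
    exact ⟨this, (P.pt j).2.2⟩
  rw [Finset.sum_eq_single ⟨0, hN⟩]
  · have h0 : (P.pt (Fin.castSucc ⟨0, hN⟩) : ℝ) = 0 := P.pt_zero
    rw [indicator_of_mem (hpos _ (Fin.succ_pos _)), h0, indicator_of_notMem (by simp), sub_zero]
  · intro j _ hj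
    have hj0 : 0 < j.castSucc := by
      rw [Fin.lt_def, Fin.val_castSucc, Fin.val_zero]
      exact Nat.pos_of_ne_zero fun hj' => hj (Fin.ext hj')
    rw [indicator_of_mem (hpos _ (Fin.succ_pos _)), indicator_of_mem (hpos _ hj0), sub_self,
      zero_apply]
  · exact fun hj => absurd (Finset.mem_univ _) hj

/-- On each interval of a fine partition the oscillation of the history is at most `ω`, so that the
Riemann-Stieltjes sum differs from the pairing by at most `(‖y‖ + ‖g‖) ω`. -/
theorem represents_iotaFun (y : StrongDual 𝕜 Y) (g : L1Interval (StrongDual 𝕜 Y) h) :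
    Represents (iotaFun y g) (pairFunctional hh (y, g)) := by
  intro φ ε hε
  set ω : ℝ := ε / (‖y‖ + ‖g‖ + 1) with hω
  have hω0 : 0 < ω := by positivity
  obtain ⟨δ, hδ, hδω⟩ := Metric.uniformContinuousOn_iff.1
    (isCompact_Icc.uniformContinuousOn_of_continuous
      (continuous_past hh φ).continuousOn (s := Icc 0 h)) ω hω0
  refine ⟨δ / 2, by positivity, fun P hP => ?_⟩
  have h0mem : (0 : ℝ) ∈ Icc 0 h := ⟨le_rfl, hh.le⟩
  have hN : 0 < P.N := by
    rcases Nat.eq_zero_or_pos P.N with hN | hN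
    · have h1 : Fin.last P.N = 0 := Fin.ext hN
      have h2 := P.pt_last
      rw [h1, P.pt_zero] at h2
      exact absurd h2 hh.ne
    · exact hN
  have hle : ∀ j : Fin P.N, (P.pt j.castSucc : ℝ) ≤ P.pt j.succ := fun j =>
    P.strictMono_pt.monotone (Fin.castSucc_lt_succ).le
  -- two points of one interval of the partition are closer than `δ`
  have hclose : ∀ (j : Fin P.N) (θ : ℝ), θ ∈ Icc (P.pt j.castSucc : ℝ) (P.pt j.succ) →
      ‖past hh φ (P.tag j) - past hh φ θ‖ ≤ ω := fun j θ hθ => by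
    rw [← dist_eq_norm]
    refine (hδω _ (P.tag j).2 θ
      ⟨(P.pt j.castSucc).2.1.trans hθ.1, hθ.2.trans (P.pt j.succ).2.2⟩ ?_).le
    have h1 : (P.pt j.castSucc : ℝ) ≤ P.tag j := P.le_tag j
    have h2 : (P.tag j : ℝ) ≤ P.pt j.succ := P.tag_le j
    have h3 := hP j
    rw [Real.dist_eq, abs_lt]
    constructor <;> linarith [hθ.1, hθ.2]
  have hgi : ∀ j : Fin P.N, IntervalIntegrable g volume (P.pt j.castSucc) (P.pt j.succ) :=
    fun j => g.intervalIntegrable (P.pt _).2 (P.pt _).2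
  have hpi : ∀ a b, a ∈ Icc 0 h → b ∈ Icc 0 h →
      IntervalIntegrable (fun θ => g θ (past hh φ θ)) volume a b := fun a b ha hb =>
    ((integrableOn_apply_past hh g.integrableOn φ).mono_set
      (ordConnected_Icc.uIcc_subset ha hb)).intervalIntegrable
  have hsum : rsSum (fun θ : Icc 0 h => φ ⟨-θ, neg_le_neg θ.2.2, neg_nonpos.2 θ.2.1⟩)
      (iotaFun y g) P = y (past hh φ (P.tag ⟨0, hN⟩)) +
        ∑ j : Fin P.N, ∫ θ in (P.pt j.castSucc : ℝ)..P.pt j.succ,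
          g θ (past hh φ (P.tag j)) := by
    have h1 : ∀ θ : Icc 0 h, φ ⟨-θ, neg_le_neg θ.2.2, neg_nonpos.2 θ.2.1⟩ = past hh φ θ :=
      fun θ => (past_of_mem hh φ θ.2).symm
    simp only [rsSum, h1, iotaFun_sub_iotaFun, add_apply]
    rw [Finset.sum_add_distrib,
      sum_indicator_increments_apply y P hN fun θ : Icc 0 h => past hh φ θ]
    congr 1
    exact Finset.sum_congr rfl fun j _ => ContinuousLinearMap.intervalIntegral_apply (hgi j) _
  have htarget : pairFunctional hh (y, g) φ = y (past hh φ 0) +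
      ∑ j : Fin P.N, ∫ θ in (P.pt j.castSucc : ℝ)..P.pt j.succ, g θ (past hh φ θ) := by
    rw [pairFunctional_apply, past_of_mem hh φ h0mem]
    congr 1
    · simp
    · have h1 := Fin.sum_univ_succ_sub_castSucc
        fun k => ∫ θ in (0 : ℝ)..(P.pt k : ℝ), g θ (past hh φ θ)
      rw [P.pt_last, P.pt_zero, intervalIntegral.integral_same, sub_zero,
        intervalIntegral.integral_of_le hh.le, ← integral_Icc_eq_integral_Ioc] at h1
      rw [← h1]
      exact Finset.sum_congr rfl fun j _ => intervalIntegral.integral_interval_sub_left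
        (hpi _ _ h0mem (P.pt _).2) (hpi _ _ h0mem (P.pt _).2)
  have hnorm : ∑ j : Fin P.N, ∫ θ in (P.pt j.castSucc : ℝ)..P.pt j.succ, ‖g θ‖ = ‖g‖ := by
    have h1 := Fin.sum_univ_succ_sub_castSucc
      fun k => ∫ θ in (0 : ℝ)..(P.pt k : ℝ), ‖g θ‖
    rw [P.pt_last, P.pt_zero, intervalIntegral.integral_same, sub_zero,
      intervalIntegral.integral_of_le hh.le, ← integral_Icc_eq_integral_Ioc] at h1
    rw [g.norm_def, ← h1]
    exact Finset.sum_congr rfl fun j _ => (intervalIntegral.integral_interval_sub_left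
      (g.intervalIntegrable h0mem (P.pt _).2).norm
      (g.intervalIntegrable h0mem (P.pt _).2).norm).symm
  rw [hsum, htarget, add_sub_add_comm, ← Finset.sum_sub_distrib]
  have hfirst : ‖y (past hh φ (P.tag ⟨0, hN⟩)) - y (past hh φ 0)‖ ≤ ‖y‖ * ω := by
    rw [← map_sub]
    refine (y.le_opNorm _).trans ?_
    gcongr
    have h0 : (P.pt (Fin.castSucc ⟨0, hN⟩) : ℝ) = 0 := P.pt_zero
    exact hclose ⟨0, hN⟩ 0 ⟨h0.le, (P.pt _).2.1⟩
  have hrest : ∀ j : Fin P.N, ‖(∫ θ in (P.pt j.castSucc : ℝ)..P.pt j.succ,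
        g θ (past hh φ (P.tag j))) - ∫ θ in (P.pt j.castSucc : ℝ)..P.pt j.succ,
        g θ (past hh φ θ)‖ ≤ (∫ θ in (P.pt j.castSucc : ℝ)..P.pt j.succ, ‖g θ‖) * ω := by
    intro j
    have h1 : IntervalIntegrable (fun θ => g θ (past hh φ (P.tag j))) volume
        (P.pt j.castSucc) (P.pt j.succ) :=
      ⟨(ContinuousLinearMap.apply 𝕜 𝕜 (past hh φ (P.tag j))).integrable_comp (hgi j).1,
        (ContinuousLinearMap.apply 𝕜 𝕜 (past hh φ (P.tag j))).integrable_comp (hgi j).2⟩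
    rw [← intervalIntegral.integral_sub h1 (hpi _ _ (P.pt _).2 (P.pt _).2)]
    simp only [← map_sub]
    rw [intervalIntegral.integral_of_le (hle j), intervalIntegral.integral_of_le (hle j)]
    refine norm_integral_strongDual_apply_le (hgi j).1 ?_
    filter_upwards [ae_restrict_mem measurableSet_Ioc] with θ hθ
    exact hclose j θ (Ioc_subset_Icc_self hθ)
  calc _ ≤ ‖y‖ * ω + ∑ j : Fin P.N,
        (∫ θ in (P.pt j.castSucc : ℝ)..P.pt j.succ, ‖g θ‖) * ω :=
        norm_add_le_of_le hfirst (norm_sum_le_of_le _ fun j _ => hrest j)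
    _ = (‖y‖ + ‖g‖) * ω := by rw [← Finset.sum_mul, hnorm, add_mul]
    _ ≤ (‖y‖ + ‖g‖ + 1) * ω := mul_le_mul_of_nonneg_right (by linarith) hω0.le
    _ = ε := by rw [hω]; field_simp

/-- The variation of a function is at most the total increase of a real function whose increments
dominate it. -/
theorem eVariationOn_univ_le_of_norm_sub_le {W : Type*} [NormedAddCommGroup W]
    {f : Icc 0 h → W} {G : Icc 0 h → ℝ} {C : ℝ}
    (hf : ∀ s t, s ≤ t → ‖f t - f s‖ ≤ G t - G s) (hC : ∀ s t, s ≤ t → G t - G s ≤ C) :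
    eVariationOn f univ ≤ ENNReal.ofReal C := by
  refine iSup_le fun p => ?_
  obtain ⟨n, u, hu, -⟩ := p
  calc ∑ i ∈ Finset.range n, edist (f (u (i + 1))) (f (u i))
      ≤ ∑ i ∈ Finset.range n, ENNReal.ofReal (G (u (i + 1)) - G (u i)) := by
        refine Finset.sum_le_sum fun i _ => ?_
        rw [edist_dist, dist_eq_norm]
        exact ENNReal.ofReal_le_ofReal (hf _ _ (hu (Nat.le_succ i)))
    _ = ENNReal.ofReal (G (u n) - G (u 0)) := by
        rw [← ENNReal.ofReal_sum_of_nonneg fun i _ =>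
          (norm_nonneg _).trans (hf _ _ (hu (Nat.le_succ i))),
          Finset.sum_range_sub fun i => G (u i)]
    _ ≤ _ := ENNReal.ofReal_le_ofReal (hC _ _ (hu (Nat.zero_le n)))

theorem eVariationOn_iotaFun_le {W : Type*} [NormedAddCommGroup W] [NormedSpace ℝ W]
    (y : W) (g : L1Interval W h) :
    eVariationOn (iotaFun y g) univ ≤ ENNReal.ofReal (‖y‖ + ‖g‖) := by
  have hind : ∀ s t : Icc 0 h, s ≤ t →
      ‖(Ioc (0 : ℝ) h).indicator (fun _ => y) (t : ℝ) -
        (Ioc (0 : ℝ) h).indicator (fun _ => y) (s : ℝ)‖ ≤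
      (Ioc (0 : ℝ) h).indicator (fun _ => ‖y‖) (t : ℝ) -
        (Ioc (0 : ℝ) h).indicator (fun _ => ‖y‖) (s : ℝ) := by
    intro s t hst
    rcases s.2.1.eq_or_lt with hs | hs
    · rw [← hs]
      simp [norm_indicator_eq_indicator_norm]
    · have ht : 0 < (t : ℝ) := hs.trans_le hst
      have hs' : (s : ℝ) ∈ Ioc 0 h := ⟨hs, s.2.2⟩
      have ht' : (t : ℝ) ∈ Ioc 0 h := ⟨ht, t.2.2⟩
      simp [indicator_of_mem hs', indicator_of_mem ht']
  have hsub : ∀ s t : Icc 0 h, (∫ θ in (0 : ℝ)..t, ‖g θ‖) - (∫ θ in (0 : ℝ)..s, ‖g θ‖) =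
      ∫ θ in (s : ℝ)..t, ‖g θ‖ := by
    intro s t
    have h0 : (0 : ℝ) ∈ Icc 0 h := ⟨le_rfl, t.2.1.trans t.2.2⟩
    exact intervalIntegral.integral_interval_sub_left
      (g.intervalIntegrable h0 t.2).norm (g.intervalIntegrable h0 s.2).norm
  refine eVariationOn_univ_le_of_norm_sub_le (G := fun t =>
    (Ioc (0 : ℝ) h).indicator (fun _ => ‖y‖) (t : ℝ) + ∫ θ in (0 : ℝ)..t, ‖g θ‖) ?_ ?_
  · intro s t hst
    rw [iotaFun_sub_iotaFun, add_sub_add_comm, hsub]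
    exact norm_add_le_of_le (hind s t hst) (intervalIntegral.norm_integral_le_integral_norm hst)
  · intro s t hst
    rw [add_sub_add_comm, hsub]
    refine add_le_add ?_ ?_
    · have h1 : (Ioc (0 : ℝ) h).indicator (fun _ => ‖y‖) (t : ℝ) ≤ ‖y‖ :=
        indicator_le_self' (fun _ _ => norm_nonneg _) _
      have h2 : 0 ≤ (Ioc (0 : ℝ) h).indicator (fun _ => ‖y‖) (s : ℝ) :=
        indicator_nonneg (fun _ _ => norm_nonneg _) _
      linarith
    · rw [intervalIntegral.integral_of_le hst, g.norm_def]
      exact setIntegral_mono_set g.integrableOn.norm (ae_of_all _ fun _ => norm_nonneg _)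
        (LE.le.eventuallyLE fun θ hθ => ⟨s.2.1.trans hθ.1.le, hθ.2.trans t.2.2⟩)

theorem eVariationOn_iotaFun (hh : 0 < h) (y : StrongDual 𝕜 Y)
    (g : L1Interval (StrongDual 𝕜 Y) h) :
    eVariationOn (iotaFun y g) univ = ENNReal.ofReal (‖y‖ + ‖g‖) := by
  refine le_antisymm (eVariationOn_iotaFun_le y g) ?_
  rw [← norm_pairFunctional hh y g]
  exact ofReal_norm_le_eVariationOn_of_represents hh (represents_iotaFun hh y g)

theorem isNBV_iotaFun {W : Type*} [NormedAddCommGroup W] [NormedSpace ℝ W]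
    (y : W) (g : L1Interval W h) : IsNBV (iotaFun y g) where
  boundedVariation := ((eVariationOn_iotaFun_le y g).trans_lt ENNReal.ofReal_lt_top).ne
  map_zero t ht := by simp [iotaFun, ht]
  right_continuous t ht0 hth := by
    refine ContinuousAt.continuousWithinAt (ContinuousAt.add ?_ ?_)
    · refine (continuousAt_const (y := y)).congr ?_
      filter_upwards [continuous_subtype_val.continuousAt.eventually_const_lt ht0] with s hs
      have hs' : (s : ℝ) ∈ Ioc 0 h := ⟨hs, s.2.2⟩
      exact (indicator_of_mem hs' fun _ => y).symm
    · have h0h : (0 : ℝ) ≤ h := ht0.le.trans hth.le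
      have h1 := intervalIntegral.continuousOn_primitive_interval (f := g) (a := 0) (b := h)
        (μ := volume) (by rw [uIcc_of_le h0h]; exact g.integrableOn)
      rw [uIcc_of_le h0h] at h1
      exact (h1.comp_continuous continuous_subtype_val fun s => s.2).continuousAt

end IotaFun

/-! ### The action of the adjoint shift semigroup -/

section Translation

theorem coeFn_translateL1 {W : Type*} [NormedAddCommGroup W] {h : ℝ} (t : ℝ≥0)
    (g : L1Interval W h) :
    translateL1 t g =ᵐ[volume.restrict (Icc 0 h)]
      fun θ => (Icc (0 : ℝ) h).indicator g (t + θ) := by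
  filter_upwards [(memLp_leftTranslate t g).coeFn_toLp, ae_restrict_mem measurableSet_Icc]
    with θ hθ hmem
  have h3 : (0 : ℝ) ≤ t + θ := add_nonneg t.2 hmem.1
  rw [translateL1, hθ]
  by_cases h4 : (t : ℝ) + θ ≤ h
  · simp [leftTranslate, h3, h4]
  · simp [leftTranslate, h4]

/-- Strong continuity at `0` of the translations on `L¹([0, h]; W)`. -/
theorem tendsto_translateL1 {W : Type*} [NormedAddCommGroup W] {h : ℝ} (g : L1Interval W h) :
    Tendsto (fun t : ℝ≥0 => translateL1 t g) (𝓝 0) (𝓝 g) := by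
  have hE : MemLp ((Icc (0 : ℝ) h).indicator g) 1 volume :=
    (memLp_indicator_iff_restrict measurableSet_Icc).2 (Lp.memLp g)
  -- extend `g` by zero to the line, where translations act continuously on `L¹`
  let sh : ℝ≥0 → C(ℝ, ℝ) := fun t => ⟨fun θ => t + θ, by fun_prop⟩
  have hsh : Continuous sh :=
    (⟨fun p : ℝ≥0 × ℝ => (p.1 : ℝ) + p.2, by fun_prop⟩ : C(ℝ≥0 × ℝ, ℝ)).curry.continuous
  have hmp : ∀ t, MeasurePreserving (sh t) volume volume := fun t =>
    measurePreserving_add_left volume (t : ℝ)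
  have h1 := (continuous_const (y := hE.toLp)).compMeasurePreservingLp hsh hmp ENNReal.one_ne_top
  have h2 := tendsto_iff_norm_sub_tendsto_zero.1 (h1.tendsto 0)
  refine tendsto_iff_norm_sub_tendsto_zero.2
    (squeeze_zero (fun _ => norm_nonneg _) (fun t => ?_) h2)
  rw [L1Interval.norm_def, L1.norm_eq_integral_norm]
  have hcoe : ∀ t : ℝ≥0, Lp.compMeasurePreserving (sh t) (hmp t) hE.toLp =ᵐ[volume]
      fun θ => (Icc (0 : ℝ) h).indicator g (t + θ) := fun t => by
    rw [Lp.toLp_compMeasurePreserving]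
    exact (hE.comp_measurePreserving (hmp t)).coeFn_toLp
  have h3 : (fun θ => ‖(translateL1 t g - g : L1Interval W h) θ‖)
      =ᵐ[volume.restrict (Icc 0 h)] fun θ => ‖(Lp.compMeasurePreserving (sh t) (hmp t) hE.toLp -
        Lp.compMeasurePreserving (sh 0) (hmp 0) hE.toLp : Lp W 1 volume) θ‖ := by
    filter_upwards [coeFn_translateL1 t g, Lp.coeFn_sub (translateL1 t g) g,
      ae_restrict_of_ae (hcoe t), ae_restrict_of_ae (hcoe 0), ae_restrict_of_ae
        (Lp.coeFn_sub (Lp.compMeasurePreserving (sh t) (hmp t) hE.toLp)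
          (Lp.compMeasurePreserving (sh 0) (hmp 0) hE.toLp)),
      ae_restrict_mem measurableSet_Icc] with θ e1 e2 e3 e4 e5 hmem
    rw [e2, e5, Pi.sub_apply, Pi.sub_apply, e1, e3, e4, NNReal.coe_zero, zero_add,
      indicator_of_mem hmem]
  rw [integral_congr_ae h3]
  exact setIntegral_le_integral (L1.integrable_coeFn _).norm (ae_of_all _ fun _ => norm_nonneg _)

theorem integral_translateL1_apply_past {𝕜 Y : Type*} [RCLike 𝕜] [NormedAddCommGroup Y]
    [NormedSpace 𝕜 Y] {h : ℝ} (hh : 0 < h) (t : ℝ≥0) (g : L1Interval (StrongDual 𝕜 Y) h)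
    (φ : C(Icc (-h) 0, Y)) :
    ∫ θ in Icc 0 h, translateL1 t g θ (past hh φ θ) =
      ∫ θ in Icc (t : ℝ) h, g θ (past hh φ (θ - t)) := by
  have ht : (0 : ℝ) ≤ t := t.2
  have h1 : ∫ θ in Icc 0 h, translateL1 t g θ (past hh φ θ) =
      ∫ θ in Icc 0 h, (Icc (0 : ℝ) h).indicator g (t + θ) (past hh φ θ) := by
    refine integral_congr_ae ?_
    filter_upwards [coeFn_translateL1 t g] with θ hθ
    rw [hθ]
  rw [h1, ← integral_indicator measurableSet_Icc]
  conv_rhs => rw [← integral_indicator measurableSet_Icc, ← integral_add_left_eq_self _ (t : ℝ)]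
  congr 1
  funext θ
  by_cases h2 : (t : ℝ) + θ ∈ Icc (t : ℝ) h
  · have h3 : θ ∈ Icc 0 h := ⟨by linarith [h2.1], by linarith [h2.2]⟩
    have h4 : (t : ℝ) + θ ∈ Icc 0 h := ⟨ht.trans h2.1, h2.2⟩
    rw [indicator_of_mem h2, indicator_of_mem h3, indicator_of_mem h4, add_sub_cancel_left]
  · rw [indicator_of_notMem h2]
    by_cases h3 : θ ∈ Icc 0 h
    · have h4 : (t : ℝ) + θ ∉ Icc 0 h := fun h4 => h2 ⟨by linarith [h3.1], h4.2⟩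
      rw [indicator_of_mem h3, indicator_of_notMem h4, zero_apply]
    · rw [indicator_of_notMem h3]

end Translation

namespace C0Semigroup

variable {𝕜 Y : Type*} [RCLike 𝕜] [NormedAddCommGroup Y] [NormedSpace 𝕜 Y]
  (S : C0Semigroup 𝕜 Y) {h : ℝ}

theorem integrableOn_orbit [CompleteSpace Y] (t : ℝ≥0) (g : L1Interval (StrongDual 𝕜 Y) h)
    (v : Y) : IntegrableOn (fun θ => g θ (S.op ((t : ℝ) - θ).toNNReal v))
      (Icc 0 (min (t : ℝ) h)) := by
  obtain ⟨M, hM⟩ := S.exists_bound t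
  have hg : IntegrableOn g (Icc 0 (min (t : ℝ) h)) :=
    g.integrableOn.mono_set (Icc_subset_Icc_right (min_le_right _ _))
  refine hg.strongDual_apply (C := M * ‖v‖) ?_ ?_
  · exact ((S.continuous_orbit v).comp (by fun_prop)).aestronglyMeasurable
  · filter_upwards [ae_restrict_mem measurableSet_Icc] with θ hθ
    refine ((S.op _).le_opNorm v).trans ?_
    gcongr
    refine hM _ ?_
    rw [Real.toNNReal_le_iff_le_coe]
    linarith [hθ.1]

theorem norm_integral_orbit_le {t : ℝ≥0} {M : ℝ} (hM : ∀ s ≤ t, ‖S.op s‖ ≤ M)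
    (g : L1Interval (StrongDual 𝕜 Y) h) (v : Y) :
    ‖∫ θ in Icc 0 (min (t : ℝ) h), g θ (S.op ((t : ℝ) - θ).toNNReal v)‖ ≤
      (∫ θ in Icc 0 (min (t : ℝ) h), ‖g θ‖) * M * ‖v‖ := by
  rw [mul_assoc]
  have hg : IntegrableOn g (Icc 0 (min (t : ℝ) h)) :=
    g.integrableOn.mono_set (Icc_subset_Icc_right (min_le_right _ _))
  refine norm_integral_strongDual_apply_le hg ?_
  filter_upwards [ae_restrict_mem measurableSet_Icc] with θ hθ
  refine ((S.op _).le_opNorm v).trans ?_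
  gcongr
  refine hM _ ?_
  rw [Real.toNNReal_le_iff_le_coe]
  linarith [hθ.1]

theorem solution_sub_of_le (hh : 0 < h) (φ : C(Icc (-h) 0, Y)) {t θ : ℝ} (hθ : t ≤ θ) :
    S.solution hh φ (t - θ) = past hh φ (θ - t) := by
  rw [solution, if_pos (sub_nonpos.2 hθ), past, neg_sub]

variable [CompleteSpace Y]

/-- The weak* integral `∫_0^{min(t,h)} S*(t - θ) g(θ) dθ`. -/
def adjConvolution (t : ℝ≥0) (g : L1Interval (StrongDual 𝕜 Y) h) : StrongDual 𝕜 Y :=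
  LinearMap.mkContinuousOfExistsBound
    { toFun := fun v => ∫ θ in Icc 0 (min (t : ℝ) h), g θ (S.op ((t : ℝ) - θ).toNNReal v)
      map_add' := fun v w => by
        simp only [map_add]
        exact integral_add (S.integrableOn_orbit t g v) (S.integrableOn_orbit t g w)
      map_smul' := fun c v => by
        simp only [map_smul]
        exact integral_smul c _ }
    (by
      obtain ⟨M, hM⟩ := S.exists_bound t
      exact ⟨_, S.norm_integral_orbit_le hM g⟩)

theorem adjConvolution_apply (t : ℝ≥0) (g : L1Interval (StrongDual 𝕜 Y) h) (v : Y) :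
    S.adjConvolution t g v =
      ∫ θ in Icc 0 (min (t : ℝ) h), g θ (S.op ((t : ℝ) - θ).toNNReal v) := rfl

theorem hasWeakStarIntegral_adjConvolution (t : ℝ≥0) (g : L1Interval (StrongDual 𝕜 Y) h) :
    HasWeakStarIntegral (fun θ => S.adj ((t : ℝ) - θ).toNNReal (g θ))
      (Icc 0 (min (t : ℝ) h)) (S.adjConvolution t g) :=
  fun v => ⟨S.integrableOn_orbit t g v, rfl⟩

theorem tendsto_adjConvolution (hh : 0 < h) (g : L1Interval (StrongDual 𝕜 Y) h) :
    Tendsto (fun t : ℝ≥0 => S.adjConvolution t g) (𝓝 0) (𝓝 0) := by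
  obtain ⟨M, hM⟩ := S.exists_bound 1
  have hM0 : 0 ≤ M := (norm_nonneg _).trans (hM 0 zero_le_one)
  have hint : Tendsto (fun t : ℝ≥0 => ∫ θ in Icc 0 (min (t : ℝ) h), ‖g θ‖) (𝓝 0) (𝓝 0) := by
    have h1 := intervalIntegral.continuousOn_primitive_interval (f := fun θ => ‖g θ‖) (a := 0)
      (b := h) (μ := volume) (by rw [uIcc_of_le hh.le]; exact g.integrableOn.norm)
    rw [uIcc_of_le hh.le] at h1
    have h2 : Continuous fun t : ℝ≥0 => ∫ θ in (0 : ℝ)..min (t : ℝ) h, ‖g θ‖ :=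
      h1.comp_continuous (f := fun t : ℝ≥0 => min (t : ℝ) h) (by fun_prop)
        fun t => ⟨le_min t.2 hh.le, min_le_right _ _⟩
    have h3 := h2.tendsto 0
    rw [NNReal.coe_zero, min_eq_left hh.le, intervalIntegral.integral_same] at h3
    refine h3.congr fun t => ?_
    rw [intervalIntegral.integral_of_le (le_min t.coe_nonneg hh.le), integral_Icc_eq_integral_Ioc]
  have hlim := hint.mul_const M
  rw [zero_mul] at hlim
  refine squeeze_zero_norm' ?_ hlim
  filter_upwards [Iic_mem_nhds (zero_lt_one : (0 : ℝ≥0) < 1)] with t ht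
  refine (S.adjConvolution t g).opNorm_le_bound ?_
    (S.norm_integral_orbit_le (fun s hs => hM s (hs.trans ht)) g)
  exact mul_nonneg (integral_nonneg fun _ => norm_nonneg _) hM0

variable (hh : 0 < h)

theorem past_shiftSemigroup_op (t : ℝ≥0) (φ : C(Icc (-h) 0, Y)) {θ : ℝ} (hθ : θ ∈ Icc 0 h) :
    past hh ((S.shiftSemigroup hh).op t φ) θ = S.solution hh φ (t - θ) := by
  rw [past_of_mem hh _ hθ, shiftSemigroup_apply, sub_eq_add_neg]

/-- The adjoint shift semigroup: for `θ ≤ t` the shifted history at `-θ` is `S(t - θ) φ(0)`, which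
feeds the weak* integral; for `θ ≥ t` it is `φ(t - θ)`, which translates the density. -/
theorem adj_pairFunctional (t : ℝ≥0) (y : StrongDual 𝕜 Y) (g : L1Interval (StrongDual 𝕜 Y) h) :
    (S.shiftSemigroup hh).adj t (pairFunctional hh (y, g)) =
      pairFunctional hh (S.adj t y + S.adjConvolution t g, translateL1 t g) := by
  ext φ
  have ht : (0 : ℝ) ≤ t := t.2
  have hm0 : 0 ≤ min (t : ℝ) h := le_min ht hh.le
  rw [adj_apply, pairFunctional_apply, pairFunctional_apply, add_apply, adj_apply,
    adjConvolution_apply, integral_translateL1_apply_past, shiftSemigroup_apply, add_zero,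
    S.solution_of_nonneg hh φ ht, Real.toNNReal_coe, add_assoc]
  congr 1
  have hsplit : Icc 0 h = Icc 0 (min (t : ℝ) h) ∪ Ioc (min (t : ℝ) h) h :=
    (Icc_union_Ioc_eq_Icc hm0 (min_le_right _ _)).symm
  have hint := integrableOn_apply_past hh g.integrableOn ((S.shiftSemigroup hh).op t φ)
  have hunion := setIntegral_union
    (disjoint_left.2 fun θ (h1 : θ ∈ Icc 0 (min (t : ℝ) h)) (h2 : θ ∈ Ioc (min (t : ℝ) h) h) =>
      absurd h1.2 (not_le.2 h2.1)) measurableSet_Ioc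
    (hint.mono_set (Icc_subset_Icc_right (min_le_right _ _)))
    (hint.mono_set (Ioc_subset_Icc_self.trans (Icc_subset_Icc_left hm0)))
  rw [← hsplit] at hunion
  rw [hunion]
  congr 1
  · refine setIntegral_congr_fun measurableSet_Icc fun θ hθ => ?_
    have hθ' : θ ∈ Icc 0 h := ⟨hθ.1, hθ.2.trans (min_le_right _ _)⟩
    rw [past_shiftSemigroup_op S hh t φ hθ', S.solution_of_nonneg hh φ
      (sub_nonneg.2 (hθ.2.trans (min_le_left _ _)))]
  · have hset : Ioc (min (t : ℝ) h) h = Ioc (t : ℝ) h := by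
      rcases le_total (t : ℝ) h with hth | hth
      · rw [min_eq_left hth]
      · rw [min_eq_right hth, Ioc_self, Ioc_eq_empty (not_lt.2 hth)]
    rw [hset, integral_Icc_eq_integral_Ioc]
    refine setIntegral_congr_fun measurableSet_Ioc fun θ hθ => ?_
    rw [past_shiftSemigroup_op S hh t φ ⟨ht.trans hθ.1.le, hθ.2⟩,
      S.solution_sub_of_le hh φ hθ.1.le]

theorem adj_pairFunctional_zero (t : ℝ≥0) (y : StrongDual 𝕜 Y) :
    (S.shiftSemigroup hh).adj t (pairFunctional hh (y, 0)) = pairFunctional hh (S.adj t y, 0) := by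
  ext φ
  have h0 : ∀ z : StrongDual 𝕜 Y, ∀ ψ, pairFunctional hh (z, (0 : L1Interval (StrongDual 𝕜 Y) h)) ψ
      = z (ψ ⟨0, neg_nonpos.2 hh.le, le_rfl⟩) := fun z ψ => by
    have : integralFunctional hh (0 : L1Interval (StrongDual 𝕜 Y) h) ψ = 0 := by
      rw [map_zero]; rfl
    rw [pairFunctional_apply, ← integralFunctional_apply, this, add_zero]
  rw [adj_apply, h0, h0, adj_apply, shiftSemigroup_apply, add_zero,
    S.solution_of_nonneg hh φ t.coe_nonneg, Real.toNNReal_coe]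

/-- The sun dual of the shift semigroup contains `(0, g)` for every `g`: neither the translation
of `g` nor the mass that it pushes into the point `0` jumps at time `0`. -/
theorem pairFunctional_zero_mem_sunDual (g : L1Interval (StrongDual 𝕜 Y) h) :
    pairFunctional hh (0, g) ∈ (S.shiftSemigroup hh).sunDual := by
  change Tendsto _ _ _
  simp only [adj_pairFunctional, map_zero, zero_add]
  exact ((pairFunctional hh).continuous.tendsto (0, g)).comp
    ((S.tendsto_adjConvolution hh g).prodMk_nhds (tendsto_translateL1 g))

/-- As all `(0, g)` lie in the sun dual, only `y` matters, and `‖T₀*(t)(y, 0) - (y, 0)‖` equals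
`‖S*(t) y - y‖`. -/
theorem pairFunctional_mem_sunDual_iff {y : StrongDual 𝕜 Y}
    {g : L1Interval (StrongDual 𝕜 Y) h} :
    pairFunctional hh (y, g) ∈ (S.shiftSemigroup hh).sunDual ↔ y ∈ S.sunDual := by
  have h1 : pairFunctional hh (y, g) = pairFunctional hh (y, 0) + pairFunctional hh (0, g) := by
    rw [← map_add, Prod.mk_add_mk, add_zero, zero_add]
  rw [h1, Submodule.add_mem_iff_left _ (S.pairFunctional_zero_mem_sunDual hh g)]
  change Tendsto _ _ _ ↔ Tendsto _ _ _
  simp only [adj_pairFunctional_zero]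
  refine tendsto_iff_norm_sub_tendsto_zero.trans
    (Iff.trans (tendsto_congr fun t => ?_) tendsto_iff_norm_sub_tendsto_zero.symm)
  rw [← map_sub, Prod.mk_sub_mk, sub_zero, norm_pairFunctional, norm_zero, add_zero]

end C0Semigroup

/-! ### Averages of elements of the sun dual -/

theorem exists_continuous_approximate_unit {δ : ℝ} (hδ : 0 < δ) :
    ∃ k : ℝ → ℝ, Continuous k ∧ HasCompactSupport k ∧ (∀ w, 0 ≤ k w) ∧
      (∀ w, w ∉ Ioo 0 δ → k w = 0) ∧ ∫ w, k w = 1 := by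
  let b : ContDiffBump (δ / 2) := ⟨δ / 4, δ / 2, by positivity, by linarith⟩
  refine ⟨b.normed volume, b.continuous_normed, b.hasCompactSupport_normed, b.nonneg_normed,
    fun w hw => ?_, b.integral_normed⟩
  rw [← Function.notMem_support, b.support_normed_eq, Real.ball_eq_Ioo]
  simpa [b] using hw

theorem IsClosed.mem_of_forall_exists_norm_sub_le {G : Type*} [SeminormedAddCommGroup G]
    {s : Set G} (hs : IsClosed s) {x : G} (H : ∀ ε > 0, ∃ z ∈ s, ‖z - x‖ ≤ ε) : x ∈ s := by
  refine hs.closure_subset (Metric.mem_closure_iff.2 fun ε hε => ?_)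
  obtain ⟨z, hz, hzx⟩ := H (ε / 2) (half_pos hε)
  refine ⟨z, hz, ?_⟩
  rw [dist_comm, dist_eq_norm]
  linarith

section Tensor

variable {𝕜 Y K : Type*} [RCLike 𝕜] [NormedAddCommGroup Y] [NormedSpace 𝕜 Y] [TopologicalSpace K]
  [CompactSpace K]

/-- The elementary tensor `(ψ ⊗ v)(θ) = ψ(θ) v` in `C(K, Y)`, as a bounded bilinear map. -/
def ContinuousMap.tensor : C(K, 𝕜) →L[𝕜] Y →L[𝕜] C(K, Y) :=
  LinearMap.mkContinuous₂
    (LinearMap.mk₂ 𝕜 (fun (ψ : C(K, 𝕜)) (v : Y) => (⟨fun θ => ψ θ • v, by fun_prop⟩ : C(K, Y)))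
      (fun ψ₁ ψ₂ v => by ext θ; exact add_smul _ _ _)
      (fun c ψ v => by ext θ; exact smul_assoc c (ψ θ) v)
      (fun ψ v₁ v₂ => by ext θ; exact smul_add _ _ _)
      (fun c ψ v => by ext θ; exact smul_comm (ψ θ) c v)) 1
    (fun ψ v => by
      rw [one_mul, ContinuousMap.norm_le _ (by positivity)]
      intro θ
      change ‖ψ θ • v‖ ≤ _
      rw [norm_smul]
      gcongr
      exact ψ.norm_coe_le_norm θ)

end Tensor

namespace C0Semigroup

section Average

variable {𝕜 E : Type*} [RCLike 𝕜] [NormedAddCommGroup E] [NormedSpace 𝕜 E]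

theorem continuous_average (T : C0Semigroup 𝕜 E) {k : ℝ → ℝ} (hk : Continuous k) (v : E) :
    Continuous fun w => (k w : 𝕜) • T.op w.toNNReal v :=
  (RCLike.continuous_ofReal.comp hk).smul ((T.continuous_orbit v).comp continuous_real_toNNReal)

theorem integrable_average (T : C0Semigroup 𝕜 E) {k : ℝ → ℝ} (hk : Continuous k)
    (hks : HasCompactSupport k) (v : E) :
    Integrable fun w => (k w : 𝕜) • T.op w.toNNReal v := by
  refine (T.continuous_average hk v).integrable_of_hasCompactSupport ?_
  exact (hks.comp_left (g := fun r : ℝ => (r : 𝕜)) RCLike.ofReal_zero).smul_right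

/-- Elements of the sun dual are norm limits of their averages `∫ k(w) T*(w) x dw` against
continuous kernels `k` that vanish on `(-∞, 0]`. -/
theorem exists_average_near (T : C0Semigroup 𝕜 E) {x : StrongDual 𝕜 E} (hx : x ∈ T.sunDual)
    {ε : ℝ} (hε : 0 < ε) :
    ∃ k : ℝ → ℝ, Continuous k ∧ HasCompactSupport k ∧ (∀ w ≤ 0, k w = 0) ∧
      ∃ z : StrongDual 𝕜 E, (∀ v, z v = ∫ w, x ((k w : 𝕜) • T.op w.toNNReal v)) ∧
        ‖z - x‖ ≤ ε := by
  have hx' : Tendsto (fun t : ℝ≥0 => T.adj t x) (𝓝 0) (𝓝 x) := hx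
  obtain ⟨δ, hδ, hclose⟩ := Metric.tendsto_nhds_nhds.1 hx' ε hε
  obtain ⟨k, hk, hks, hk0, hkz, hk1⟩ := exists_continuous_approximate_unit hδ
  have hki : Integrable k := hk.integrable_of_hasCompactSupport hks
  have hint : ∀ v, Integrable fun w => x ((k w : 𝕜) • T.op w.toNNReal v) := fun v =>
    x.integrable_comp (T.integrable_average hk hks v)
  have hdiff : ∀ w v, ‖x ((k w : 𝕜) • T.op w.toNNReal v) - (k w : 𝕜) * x v‖ ≤
      k w * (ε * ‖v‖) := fun w v => by
    by_cases hw : w ∈ Ioo 0 δ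
    · have h1 : dist w.toNNReal 0 < δ := by
        rw [NNReal.dist_eq, Real.coe_toNNReal _ hw.1.le, NNReal.coe_zero, sub_zero,
          abs_of_pos hw.1]
        exact hw.2
      have h2 := (hclose h1).le
      rw [dist_eq_norm] at h2
      rw [map_smul, smul_eq_mul, ← mul_sub, norm_mul, RCLike.norm_ofReal, abs_of_nonneg (hk0 w)]
      gcongr
      · exact hk0 w
      · exact ((T.adj w.toNNReal x - x).le_opNorm v).trans (by gcongr)
    · rw [hkz w hw]; simp
  have hconst : ∀ v, ∫ w, (k w : 𝕜) * x v = x v := fun v => by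
    rw [integral_mul_const, integral_ofReal, hk1, RCLike.ofReal_one, one_mul]
  have hconsti : ∀ v, Integrable fun w => (k w : 𝕜) * x v := fun v => hki.ofReal.mul_const _
  have hbound : ∀ v, ‖(∫ w, x ((k w : 𝕜) • T.op w.toNNReal v)) - x v‖ ≤ ε * ‖v‖ := fun v => by
    rw [← hconst v, ← integral_sub (hint v) (hconsti v)]
    refine (norm_integral_le_of_norm_le (hki.mul_const _) (ae_of_all _ fun w => hdiff w v)).trans ?_
    rw [integral_mul_const, hk1, one_mul]
  let z : StrongDual 𝕜 E := LinearMap.mkContinuousOfExistsBound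
    { toFun := fun v => ∫ w, x ((k w : 𝕜) • T.op w.toNNReal v)
      map_add' := fun v v' => by
        simp only [map_add, smul_add]
        exact integral_add (hint v) (hint v')
      map_smul' := fun c v => by
        simp only [map_smul, RingHom.id_apply]
        rw [← integral_smul]
        exact integral_congr_ae (ae_of_all _ fun w => smul_comm _ _ _) }
    ⟨ε + ‖x‖, fun v => by
      have h1 := norm_le_norm_sub_add (∫ w, x ((k w : 𝕜) • T.op w.toNNReal v)) (x v)
      rw [add_mul]
      exact h1.trans (add_le_add (hbound v) (x.le_opNorm v))⟩
  exact ⟨k, hk, hks, fun w hw => hkz w fun hw' => absurd hw'.1 (not_lt.2 hw), z, fun v => rfl,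
    ContinuousLinearMap.opNorm_le_bound _ hε.le hbound⟩

end Average

variable {𝕜 Y : Type*} [RCLike 𝕜] [NormedAddCommGroup Y] [NormedSpace 𝕜 Y] [CompleteSpace Y]
  (S : C0Semigroup 𝕜 Y) {h : ℝ} (hh : 0 < h)

/-- On histories vanishing at `0` the average of `T₀` is the average of the translates of the
history, extended by zero: substituting `s = -(w + θ)` moves the translation onto the kernel. -/
theorem integral_shiftSemigroup_apply [NormedSpace ℝ Y] {k : ℝ → ℝ} (hk0 : ∀ w ≤ 0, k w = 0)
    {φ : C(Icc (-h) 0, Y)} (hφ : φ ⟨0, neg_nonpos.2 hh.le, le_rfl⟩ = 0) (θ : Icc (-h) 0) :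
    ∫ w, (k w : 𝕜) • (S.shiftSemigroup hh).op w.toNNReal φ θ =
      ∫ s in Icc 0 h, (k (-θ - s) : 𝕜) • past hh φ s := by
  rw [← integral_sub_left_eq_self _ volume (-(θ : ℝ)), ← integral_indicator measurableSet_Icc]
  congr 1
  funext s
  rcases le_or_gt (-(θ : ℝ) - s) 0 with hs | hs
  · rw [hk0 _ hs]
    rw [RCLike.ofReal_zero, zero_smul, indicator_apply]
    split_ifs
    · rw [hk0 _ hs, RCLike.ofReal_zero, zero_smul]
    · rfl
  · rw [shiftSemigroup_apply, Real.coe_toNNReal _ hs.le]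
    have e : -(θ : ℝ) - s + θ = -s := by ring
    rw [e]
    by_cases hmem : s ∈ Icc 0 h
    · have e' : S.solution hh φ (-s) = past hh φ s := by
        simpa using S.solution_sub_of_le hh φ hmem.1
      rw [indicator_of_mem hmem, e']
    · have hs0 : s < 0 := by
        by_contra hcon
        exact hmem ⟨not_lt.1 hcon, by linarith [θ.2.1]⟩
      rw [indicator_of_notMem hmem, S.solution_of_nonneg hh φ (by linarith)]
      have : φ ⟨0, by simp [hh.le]⟩ = 0 := hφ
      rw [this, map_zero, smul_zero]

/-- The average of `x` against `k` consists of a functional of the value at `0` and a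
density `g` with `⟨v, g(s)⟩ = ⟨k(-· - s) ⊗ v, x⟩`, which is norm-continuous because `k` is. -/
theorem average_mem_range_pairFunctional {k : ℝ → ℝ} (hk : Continuous k)
    (hks : HasCompactSupport k) (hk0 : ∀ w ≤ 0, k w = 0)
    {x z : StrongDual 𝕜 C(Icc (-h) 0, Y)}
    (hz : ∀ φ, z φ = ∫ w, x ((k w : 𝕜) • (S.shiftSemigroup hh).op w.toNNReal φ)) :
    z ∈ range (pairFunctional (𝕜 := 𝕜) (Y := Y) hh) := by
  let : NormedSpace ℝ Y := NormedSpace.restrictScalars ℝ 𝕜 Y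
  let K : C(ℝ, C(Icc (-h) 0, 𝕜)) :=
    (⟨fun p : ℝ × Icc (-h) 0 => (k (-p.2 - p.1) : 𝕜), by fun_prop⟩ :
      C(ℝ × Icc (-h) 0, 𝕜)).curry
  let g₀ : ℝ → StrongDual 𝕜 Y := fun s => x.comp (ContinuousMap.tensor (K s))
  have hg₀ : Continuous g₀ := by
    have := (ContinuousMap.tensor (𝕜 := 𝕜) (Y := Y) (K := Icc (-h) 0)).continuous.comp K.continuous
    exact continuous_const.clm_comp this
  have hg₀m : MemLp g₀ 1 (volume.restrict (Icc 0 h)) :=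
    memLp_one_iff_integrable.2 hg₀.continuousOn.integrableOn_Icc
  let g : L1Interval (StrongDual 𝕜 Y) h := hg₀m.toLp
  have hg : ∀ φ, integralFunctional hh g φ = ∫ s in Icc 0 h, g₀ s (past hh φ s) := fun φ => by
    rw [integralFunctional_apply]
    refine integral_congr_ae ?_
    filter_upwards [hg₀m.coeFn_toLp] with s hs
    rw [hs]
  -- on histories vanishing at `0` the functional `z` has density `g`
  have hzero : ∀ φ : C(Icc (-h) 0, Y), φ ⟨0, neg_nonpos.2 hh.le, le_rfl⟩ = 0 →
      z φ = integralFunctional hh g φ := fun φ hφ => by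
    have hint := (S.shiftSemigroup hh).integrable_average hk hks φ
    have hcont : Continuous fun s => ContinuousMap.tensor (K s) (past hh φ s) :=
      ((ContinuousMap.tensor.continuous.comp K.continuous).clm_apply (continuous_past hh φ))
    have hint' : IntegrableOn (fun s => ContinuousMap.tensor (K s) (past hh φ s)) (Icc 0 h) :=
      hcont.continuousOn.integrableOn_Icc
    rw [hz, hg, x.integral_comp_comm hint]
    change _ = ∫ s in Icc 0 h, x (ContinuousMap.tensor (K s) (past hh φ s))
    rw [x.integral_comp_comm hint']
    congr 1
    ext θ
    have e1 := (ContinuousMap.evalCLM 𝕜 θ : C(Icc (-h) 0, Y) →L[𝕜] Y).integral_comp_comm hint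
    have e2 := (ContinuousMap.evalCLM 𝕜 θ : C(Icc (-h) 0, Y) →L[𝕜] Y).integral_comp_comm hint'
    exact e1.symm.trans ((S.integral_shiftSemigroup_apply hh hk0 hφ θ).trans e2)
  let c : Y →L[𝕜] C(Icc (-h) 0, Y) := ContinuousMap.tensor 1
  have hc : ∀ v θ, c v θ = v := fun v θ => one_smul 𝕜 v
  -- hence the remaining part of `z` only sees the value of the history at `0`
  refine ⟨((z - integralFunctional hh g).comp c, g), ?_⟩
  ext φ
  rw [pairFunctional_apply, ← integralFunctional_apply]
  set v := φ ⟨0, neg_nonpos.2 hh.le, le_rfl⟩ with hv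
  have h1 := hzero (φ - c v) (by
    rw [ContinuousMap.sub_apply, hc, sub_self])
  rw [map_sub, map_sub] at h1
  change z (c v) - integralFunctional hh g (c v) + integralFunctional hh g φ = z φ
  linear_combination -h1

theorem mem_range_pairFunctional_of_mem_sunDual {x : StrongDual 𝕜 C(Icc (-h) 0, Y)}
    (hx : x ∈ (S.shiftSemigroup hh).sunDual) :
    x ∈ range (pairFunctional (𝕜 := 𝕜) (Y := Y) hh) := by
  refine (isClosed_range_pairFunctional hh).mem_of_forall_exists_norm_sub_le fun ε hε => ?_
  obtain ⟨k, hk, hks, hk0, z, hz, hzx⟩ :=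
    (S.shiftSemigroup hh).exists_average_near hx hε
  exact ⟨z, S.average_mem_range_pairFunctional hh hk hks hk0 hz, hzx⟩

end C0Semigroup

/-! ### The isometric isomorphism -/

section Equiv

variable {𝕜 E F G : Type*} [RCLike 𝕜] [NormedAddCommGroup E] [NormedSpace 𝕜 E]
  [NormedAddCommGroup F] [NormedSpace 𝕜 F] [NormedAddCommGroup G] [NormedSpace 𝕜 G]

/-- A linear map on `E × F` that is isometric for the sum norm restricts to an isometric
isomorphism of `p × F` with `q` if `q` lies in its range and `p × F` is the preimage of `q`. -/
def Submodule.equivOfNormEqAdd (p : Submodule 𝕜 E) (q : Submodule 𝕜 G) (f : E × F →ₗ[𝕜] G)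
    (hf : ∀ a b, ‖f (a, b)‖ = ‖a‖ + ‖b‖) (hmem : ∀ a b, f (a, b) ∈ q ↔ a ∈ p)
    (hq : ∀ x ∈ q, x ∈ range f) : WithLp 1 (p × F) ≃ₗᵢ[𝕜] q :=
  let ι : WithLp 1 (p × F) →ₗᵢ[𝕜] q :=
    { toFun := fun u => ⟨f (u.fst, u.snd), (hmem _ _).2 u.fst.2⟩
      map_add' := fun u v => Subtype.ext (map_add f ((u.fst : E), u.snd) ((v.fst : E), v.snd))
      map_smul' := fun c u => Subtype.ext (map_smul f c ((u.fst : E), u.snd))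
      norm_map' := fun u => by
        rw [WithLp.prod_norm_eq_of_L1]
        exact hf u.fst u.snd }
  LinearIsometryEquiv.ofSurjective ι fun ⟨x, hx⟩ => by
    obtain ⟨⟨y, g⟩, rfl⟩ := hq x hx
    exact ⟨WithLp.toLp 1 (⟨y, (hmem _ _).1 hx⟩, g), rfl⟩

end Equiv

namespace C0Semigroup

variable {𝕜 Y : Type*} [RCLike 𝕜] [NormedAddCommGroup Y] [NormedSpace 𝕜 Y] [CompleteSpace Y]
  (S : C0Semigroup 𝕜 Y) {h : ℝ} (hh : 0 < h)

/-- The isometric isomorphism `(y, g) ↦ χ₀ y + ∫_0^· g` of `Y^⊙ × L¹([0, h]; Y*)` with the sun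
dual of the shift semigroup, with its values taken as functionals. -/
def sunDualEquiv : WithLp 1 (S.sunDual × L1Interval (StrongDual 𝕜 Y) h) ≃ₗᵢ[𝕜]
    (S.shiftSemigroup hh).sunDual :=
  Submodule.equivOfNormEqAdd S.sunDual (S.shiftSemigroup hh).sunDual
    (pairFunctional hh).toLinearMap (norm_pairFunctional hh)
    (fun _ _ => S.pairFunctional_mem_sunDual_iff hh)
    fun _ hx => S.mem_range_pairFunctional_of_mem_sunDual hh hx

theorem coe_sunDualEquiv (y : S.sunDual) (g : L1Interval (StrongDual 𝕜 Y) h) :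
    (S.sunDualEquiv hh (WithLp.toLp 1 (y, g)) : StrongDual 𝕜 C(Icc (-h) 0, Y)) =
      pairFunctional hh ((y : StrongDual 𝕜 Y), g) := rfl

theorem adjConvolution_mem_sunDual (hh : 0 < h) (t : ℝ≥0) (g : L1Interval (StrongDual 𝕜 Y) h) :
    S.adjConvolution t g ∈ S.sunDual := by
  have h1 := (S.shiftSemigroup hh).adj_mem_sunDual t
    ⟨_, S.pairFunctional_zero_mem_sunDual hh g⟩
  simp only [adj_pairFunctional, map_zero, zero_add] at h1
  exact (S.pairFunctional_mem_sunDual_iff hh).1 h1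

end C0Semigroup

end

theorem mainTheorem1 {𝕜 Y : Type*} [RCLike 𝕜] [NormedAddCommGroup Y] [NormedSpace 𝕜 Y]
    [CompleteSpace Y] (S : C0Semigroup 𝕜 Y) (h : ℝ) (hh : 0 < h) :
    {f : Icc 0 h → StrongDual 𝕜 Y |
        IsNBV f ∧ ∃ x ∈ (S.shiftSemigroup hh).sunDual, Represents f x} =
      {f | ∃ (y : S.sunDual) (g : L1Interval (StrongDual 𝕜 Y) h),
        ∀ t, f t = iotaFun (y : StrongDual 𝕜 Y) g t} ∧
    ∃ ι : WithLp 1 (S.sunDual × L1Interval (StrongDual 𝕜 Y) h) ≃ₗᵢ[𝕜]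
        (S.shiftSemigroup hh).sunDual,
      ∀ (y : S.sunDual) (g : L1Interval (StrongDual 𝕜 Y) h),
        -- `ι (y, g)` is the functional represented by the function `iotaFun y g`, whose total
        -- variation is the norm of `(y, g)`
        Represents (iotaFun (y : StrongDual 𝕜 Y) g)
          (ι (WithLp.toLp 1 (y, g)) : StrongDual 𝕜 C(Icc (-h) 0, Y)) ∧
        eVariationOn (iotaFun (y : StrongDual 𝕜 Y) g) univ = ENNReal.ofReal (‖y‖ + ‖g‖) ∧
        -- the duality pairing
        (∀ φ : C(Icc (-h) 0, Y),
          IntegrableOn (fun θ => g θ (IccExtend (neg_nonpos.2 hh.le) φ (-θ))) (Icc 0 h) ∧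
          (ι (WithLp.toLp 1 (y, g)) : StrongDual 𝕜 C(Icc (-h) 0, Y)) φ =
            (y : StrongDual 𝕜 Y) (φ ⟨0, neg_nonpos.2 hh.le, le_rfl⟩) +
              ∫ θ in Icc 0 h, g θ (IccExtend (neg_nonpos.2 hh.le) φ (-θ))) ∧
        -- the action of the sun semigroup
        ∀ t : ℝ≥0, ∃ v : S.sunDual,
          HasWeakStarIntegral (fun θ => S.adj ((t : ℝ) - θ).toNNReal (g θ))
            (Icc 0 (min (t : ℝ) h)) (v : StrongDual 𝕜 Y) ∧
          (S.shiftSemigroup hh).sunOp t (ι (WithLp.toLp 1 (y, g))) =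
            ι (WithLp.toLp 1 (S.sunOp t y + v, translateL1 t g)) := by
  refine ⟨?_, S.sunDualEquiv hh, fun y g => ⟨?_, eVariationOn_iotaFun hh _ g,
    fun φ => ⟨integrableOn_apply_past hh g.integrableOn φ, ?_⟩,
    fun t => ⟨⟨S.adjConvolution t g, S.adjConvolution_mem_sunDual hh t g⟩,
      S.hasWeakStarIntegral_adjConvolution t g, ?_⟩⟩⟩
  rotate_left
  · rw [S.coe_sunDualEquiv hh]
    exact represents_iotaFun hh _ g
  · rw [S.coe_sunDualEquiv hh]
    exact pairFunctional_apply hh _ g φ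
  · apply Subtype.ext
    rw [S.coe_sunDualEquiv hh]
    exact S.adj_pairFunctional hh t _ g
  ext f
  constructor
  · rintro ⟨hf, x, hx, hfx⟩
    obtain ⟨⟨y, g⟩, rfl⟩ := S.mem_range_pairFunctional_of_mem_sunDual hh hx
    refine ⟨⟨y, (S.pairFunctional_mem_sunDual_iff hh).1 hx⟩, g, fun t => ?_⟩
    rw [hf.eq_of_represents hh (isNBV_iotaFun y g) hfx (represents_iotaFun hh y g)]
  · rintro ⟨y, g, hf⟩
    have hf' : f = iotaFun (y : StrongDual 𝕜 Y) g := funext hf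
    rw [hf']
    exact ⟨isNBV_iotaFun _ g, pairFunctional hh ((y : StrongDual 𝕜 Y), g),
      (S.pairFunctional_mem_sunDual_iff hh).2 y.2, represents_iotaFun hh _ g⟩
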